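/- Bicomplex numbers are $W=u+vj$ with $u,v\in\mathbb C$, $j^2=1$, $ij=ji$; put $\overline W=u-vj$, $\mathcal R(W)=u$, $\mathcal I(W)=v$. For a bicomplex function of real variables $(\xi,t)$ let $\partial_{\bar z}=\frac12(\partial_\xi-j\partial_t)$. Derivatives at boundary points of a domain are taken within that domain. Let $J\ni 0$ and $S$ be non-degenerate intervals of $\mathbb R$ (of any type), $f:J\to\mathbb R$ a non-vanishing $C^2$ function with $f(0)=1$, and $W_0:S\to\{u+vj\}$ continuously differentiable. Let $$D=\{(\xi,t):\ \xi\in J,\ t-\xi\in S,\ t+\xi\in S\}.$$ For $g=f$ or $g=1/f$ put $$T_g u(\xi)=u(\xi)+\int_{-\xi}^{\xi}\mathbf K_g(\xi,\tau)u(\tau)\,d\tau ,$$ where $\mathbf K_g$, a continuous function on $\{(\xi,\tau):\xi\in J,\ |\tau|\le|\xi|\}$, is the solution of the Goursat problem $$\Bigl(\partial_\xi^2-\tfrac{g''(\xi)}{g(\xi)}\Bigr)\mathbf K_g=\partial_\tau^2\mathbf K_g,\qquad \mathbf K_g(\xi,\xi)=\frac{g'(0)}2+\frac12\int_0^\xi\frac{g''(s)}{g(s)}\,ds,\qquad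 \mathbf K_g(\xi,-\xi)=\frac{g'(0)}2,$$ understood in integrated form: with $q=g''/g$, $$\mathbf K_g(\xi,\tau)=\frac{g'(0)}2+\frac12\int_0^{\frac{\xi+\tau}2}q(s)\,ds+\int_0^{\frac{\xi+\tau}2}\!\!\int_0^{\frac{\xi-\tau}2}q(a+b)\,\mathbf K_g(a+b,a-b)\,db\,da .$$ **(1)** The kernels $\mathbf K_f$ and $\mathbf K_{1/f}$ exist, are unique, and are continuously differentiable. The Cauchy problem for the hyperbolic Vekua equation $$\partial_{\bar z}W-\frac{f'}{2f}\overline W=0\ \text{ in } D,\qquad W(0,t)=W_0(t)\quad(t\in S),$$ has exactly one continuously differentiable solution $W$ on $D$, namely $$W(\xi,t)=\frac12\,T_f\bigl[W_0^+(t+\xi)+W_0^-(t-\xi)\bigr]+\frac j2\,T_{1/f}\bigl[W_0^+(t+\xi)-W_0^-(t-\xi)\bigr],\qquad W_0^\pm=\mathcal R(W_0)\pm\mathcal I(W_0),$$ where $T_f$ and $T_{1/f}$ act with respect to the variable $\xi$. **(2)** The problem is equivalent to the transmission problem for the $1+1$ Maxwell system, in the following sense. Let $X\ni0$ be a non-degenerate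 interval, $\varepsilon:X\to(0,\infty)$ a $C^2$ function, $\mu>0$ a constant, $c=1/\sqrt{\varepsilon\mu}$, $\xi(x)=\sqrt\mu\int_0^x\sqrt{\varepsilon(s)}\,ds$, $J=\xi(X)$, and let $f$ be defined on $J$ by $f(\xi(x))=\sqrt{c(0)}/\sqrt{c(x)}$. Then $\xi$ is strictly increasing on $X$, and $J$ and $f$ satisfy the assumptions made in (1). Let $S$ be a non-degenerate interval, $D$ as above for $J$ and $S$, and $D_X=\{(x,t): x\in X,\ (\xi(x),t)\in D\}$. For $\mathcal E_0,\mathcal H_0\in C^1(S,\mathbb C)$ and functions $\mathcal E,\mathcal H:D_X\to\mathbb C$ let $W$ be the function on $D$ with $$W(\xi(x),t)=\sqrt{c(x)}\Bigl(\sqrt{\varepsilon(x)}\,\mathcal E(x,t)+ij\sqrt\mu\,\mathcal H(x,t)\Bigr),\qquad (x,t)\in D_X.$$ Then $(\mathcal E,\mathcal H)$ is a continuously differentiable solution on $D_X$ of $$\varepsilon\,\partial_t\mathcal E=i\,\partial_x\mathcal H,\qquad i\,\partial_x\mathcal E=-\mu\,\partial_t\mathcal H,\qquad \mathcal E(0,t)=\mathcal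 E_0(t),\quad \mathcal H(0,t)=\mathcal H_0(t)\quad(t\in S)$$ if and only if $W$ is a continuously differentiable solution on $D$ of the Cauchy problem in (1) with $$W_0=\sqrt{c(0)\varepsilon(0)}\,\mathcal E_0+ij\sqrt{c(0)\mu}\,\mathcal H_0 .$$ -/

import Mathlib

open Set MeasureTheory

noncomputable section

/-- Bicomplex numbers `u + v j` with `u, v : ℂ`, where `j ^ 2 = 1` and `j` commutes with `ℂ`.
The components are `𝓡 W = W.re` and `𝓘 W = W.im`, and the conjugation `u + v j ↦ u - v j` with
respect to `j` is `star`. -/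
abbrev Bicomplex : Type := QuadraticAlgebra ℂ 1 0

namespace Bicomplex

/-- The hyperbolic imaginary unit. -/
def j : Bicomplex := ⟨0, 1⟩

/-- The embedding of the complex scalars. -/
def ofC (z : ℂ) : Bicomplex := ⟨z, 0⟩

theorem j_mul_j : j * j = 1 := by
  ext <;> simp [j, QuadraticAlgebra.re_one, QuadraticAlgebra.im_one]

theorem eq_re_add_im (W : Bicomplex) : W = ofC W.re + ofC W.im * j := by
  ext <;> simp [j, ofC]

theorem star_eq (W : Bicomplex) : star W = ofC W.re - ofC W.im * j := by
  ext <;> simp [j, ofC]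

/-- `W₀⁺ = 𝓡 W₀ + 𝓘 W₀`. -/
def plus (W : Bicomplex) : ℂ := W.re + W.im

/-- `W₀⁻ = 𝓡 W₀ - 𝓘 W₀`. -/
def minus (W : Bicomplex) : ℂ := W.re - W.im

/-- A bicomplex function is continuously differentiable on `D` if its two complex components
are. -/
def C1On {E : Type*} [NormedAddCommGroup E] [NormedSpace ℝ E] (W : E → Bicomplex) (D : Set E) :
    Prop :=
  ContDiffOn ℝ 1 (fun p => (W p).re) D ∧ ContDiffOn ℝ 1 (fun p => (W p).im) D

/-- Directional derivative within `D`, taken componentwise. -/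
def dirDeriv (W : ℝ × ℝ → Bicomplex) (D : Set (ℝ × ℝ)) (p e : ℝ × ℝ) : Bicomplex :=
  ⟨fderivWithin ℝ (fun q => (W q).re) D p e, fderivWithin ℝ (fun q => (W q).im) D p e⟩

/-- The operator `∂_{z̄} = (∂_ξ - j ∂_t) / 2`; points of the plane are pairs `(ξ, t)`. -/
def dbar (W : ℝ × ℝ → Bicomplex) (D : Set (ℝ × ℝ)) (p : ℝ × ℝ) : Bicomplex :=
  ofC (1 / 2) * (dirDeriv W D p (1, 0) - j * dirDeriv W D p (0, 1))

end Bicomplex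

open Bicomplex

/-- The domain on which data prescribed at `ξ = 0` for `t ∈ S` determine the solution: the points
`(ξ, t)` with `ξ ∈ J` for which both characteristics through `(ξ, t)` meet `ξ = 0` in `S`. -/
def cauchyDomain (J S : Set ℝ) : Set (ℝ × ℝ) :=
  {p | p.1 ∈ J ∧ p.2 - p.1 ∈ S ∧ p.2 + p.1 ∈ S}

/-- `W` is a continuously differentiable solution on `cauchyDomain J S` of the Cauchy problem
`∂_{z̄} W - (f' / (2 f)) W̄ = 0`, `W (0, t) = W₀ t` for `t ∈ S`. -/
structure IsVekuaSolution (J S : Set ℝ) (f : ℝ → ℝ) (W₀ : ℝ → Bicomplex)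
    (W : ℝ × ℝ → Bicomplex) : Prop where
  contDiff : C1On W (cauchyDomain J S)
  equation : ∀ p ∈ cauchyDomain J S,
    dbar W (cauchyDomain J S) p -
      ofC ((derivWithin f J p.1 / (2 * f p.1) : ℝ) : ℂ) * star (W p) = 0
  initial : ∀ t ∈ S, W (0, t) = W₀ t

/-- The domain `ξ ∈ J`, `|τ| ≤ |ξ|` of a Volterra kernel `K (ξ, τ)`. -/
def kernelDomain (J : Set ℝ) : Set (ℝ × ℝ) := {p | p.1 ∈ J ∧ |p.2| ≤ |p.1|}

/-- `K` solves the Goursat problem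
`(∂_ξ² - q(ξ)) K = ∂_τ² K`, `K(ξ, ξ) = h / 2 + (1/2) ∫₀^ξ q`, `K(ξ, -ξ) = h / 2`
on `kernelDomain J`. In the characteristic coordinates `a = (ξ + τ) / 2`, `b = (ξ - τ) / 2` the
equation is `∂_a ∂_b K = q(a + b) K`; for `q` merely continuous it is understood, as usual, in the
form integrated over the characteristic rectangle. -/
def IsGoursatKernel (J : Set ℝ) (q : ℝ → ℝ) (h : ℝ) (K : ℝ × ℝ → ℝ) : Prop :=
  ContinuousOn K (kernelDomain J) ∧
  ∀ p ∈ kernelDomain J,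
    K p = h / 2 + (1 / 2) * (∫ s in (0 : ℝ)..((p.1 + p.2) / 2), q s) +
      ∫ a in (0 : ℝ)..((p.1 + p.2) / 2), ∫ b in (0 : ℝ)..((p.1 - p.2) / 2),
        q (a + b) * K (a + b, a - b)

/-- The potential `q_f = f'' / f`, i.e. the one for which `f'' - q_f f = 0`. -/
def darbouxPotential (J : Set ℝ) (f : ℝ → ℝ) (ξ : ℝ) : ℝ :=
  derivWithin (derivWithin f J) J ξ / f ξ

/-- `K` is the integral kernel `𝐊_f` of the transmutation operator `T_f`
(for a non-vanishing `f` with `f 0 = 1`): the potential is `f'' / f` and the parameter is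
`f' 0`. -/
def IsTransmutationKernel (J : Set ℝ) (f : ℝ → ℝ) (K : ℝ × ℝ → ℝ) : Prop :=
  IsGoursatKernel J (darbouxPotential J f) (derivWithin f J 0) K

/-- The kernel `𝐊_f`. That it exists and is unique on `kernelDomain J` is a part of the theorem. -/
def transmutationKernel (J : Set ℝ) (f : ℝ → ℝ) : ℝ × ℝ → ℝ :=
  Classical.epsilon (IsTransmutationKernel J f)

/-- The Volterra operator `T_f u (ξ) = u(ξ) + ∫_{-ξ}^{ξ} 𝐊_f(ξ, τ) u(τ) dτ`. -/
def transmutation (J : Set ℝ) (f : ℝ → ℝ) (u : ℝ → ℂ) (ξ : ℝ) : ℂ :=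
  u ξ + ∫ τ in (-ξ)..ξ, (transmutationKernel J f (ξ, τ) : ℂ) * u τ

/-- The function
`(1/2) T_f[W₀⁺(t + ξ) + W₀⁻(t - ξ)] + (j/2) T_{1/f}[W₀⁺(t + ξ) - W₀⁻(t - ξ)]` of `(ξ, t)`, where
the operators act with respect to the variable `ξ`. -/
def vekuaFormula (J : Set ℝ) (f : ℝ → ℝ) (W₀ : ℝ → Bicomplex) (p : ℝ × ℝ) : Bicomplex :=
  ofC (1 / 2) *
      ofC (transmutation J f (fun τ => plus (W₀ (p.2 + τ)) + minus (W₀ (p.2 - τ))) p.1) +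
    ofC (1 / 2) * j *
      ofC (transmutation J (fun ξ => (f ξ)⁻¹)
        (fun τ => plus (W₀ (p.2 + τ)) - minus (W₀ (p.2 - τ))) p.1)

/-- The wave velocity `c(x) = 1 / √(ε(x) μ)`. -/
def waveSpeed (ε : ℝ → ℝ) (μ x : ℝ) : ℝ := 1 / √(ε x * μ)

/-- The new variable `ξ(x) = √μ ∫₀ˣ √(ε(s)) ds`. -/
def travelTime (ε : ℝ → ℝ) (μ x : ℝ) : ℝ := √μ * ∫ s in (0 : ℝ)..x, √(ε s)

/-- `cauchyDomain` in the original variables `(x, t)`. -/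
def maxwellDomain (X S : Set ℝ) (ε : ℝ → ℝ) (μ : ℝ) : Set (ℝ × ℝ) :=
  {p | p.1 ∈ X ∧ (travelTime ε μ p.1, p.2) ∈ cauchyDomain (travelTime ε μ '' X) S}

/-- `(E, H)` is a continuously differentiable solution of the 1+1 Maxwell system
`ε ∂_t E = i ∂_x H`, `i ∂_x E = -μ ∂_t H` with `E(0, t) = E₀ t`, `H(0, t) = H₀ t` for `t ∈ S`. -/
structure IsMaxwellSolution (X S : Set ℝ) (ε : ℝ → ℝ) (μ : ℝ) (E₀ H₀ : ℝ → ℂ)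
    (E H : ℝ × ℝ → ℂ) : Prop where
  contDiff_E : ContDiffOn ℝ 1 E (maxwellDomain X S ε μ)
  contDiff_H : ContDiffOn ℝ 1 H (maxwellDomain X S ε μ)
  equation_H : ∀ p ∈ maxwellDomain X S ε μ,
    (ε p.1 : ℂ) * fderivWithin ℝ E (maxwellDomain X S ε μ) p (0, 1) =
      Complex.I * fderivWithin ℝ H (maxwellDomain X S ε μ) p (1, 0)
  equation_E : ∀ p ∈ maxwellDomain X S ε μ,
    Complex.I * fderivWithin ℝ E (maxwellDomain X S ε μ) p (1, 0) =
      -(μ : ℂ) * fderivWithin ℝ H (maxwellDomain X S ε μ) p (0, 1)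
  initial_E : ∀ t ∈ S, E (0, t) = E₀ t
  initial_H : ∀ t ∈ S, H (0, t) = H₀ t

end

/-! Put p = f'/f, so that f''/f = p' + p², and passing from f to 1/f replaces p by -p. Instead of
solving two second order Goursat problems, one solves for both kernels K = `𝐊_f` and L = `𝐊_{1/f}`
at once. In the characteristic coordinates a = (ξ + τ)/2, b = (ξ - τ)/2 the functions P = K + L and
M = K - L satisfy P_a = p M, M_b = p P with P(0, b) = 0 and M(a, 0) = p(a). This Volterra system is
solved by a contraction in an exponentially weighted norm (`exists_goursat_system`). Differentiating
it shows that the kernels are C¹ although f''/f is only continuous. It also gives K_ξ + L_τ = p K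
together with the boundary values of K ∓ L on τ = ±ξ (`IsGoursatSystem.isDarbouxPair`).

Integration by parts turns these relations into (∂_ξ - p) T_f = T_{1/f} ∂_ξ and, by symmetry, (∂_ξ +
p) T_{1/f} = T_f ∂_ξ (`IsDarbouxPair.volterraTransform_intertwine`). The waves φ = W₀⁺(t + ξ) +
W₀⁻(t - ξ) and ψ = W₀⁺(t + ξ) - W₀⁻(t - ξ) satisfy φ_ξ = ψ_t and ψ_ξ = φ_t, so the components T_f φ
/ 2 and T_{1/f} ψ / 2 satisfy the componentwise Vekua system.

Everything is local: near a point only the data on compact subintervals enter, and these extend to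
C¹ data on the line (`exists_contDiff_extension`). The kernels glue by Volterra uniqueness. This
also covers boundary points of intervals of any type.

Uniqueness for the Cauchy problem is an energy-free estimate: the sum and the difference of the
components of the difference of two solutions obey ordinary differential equations along the two
families of characteristics (`characteristic_system_unique`).

For Maxwell, c √ε √μ = 1 gives W = F E + j F⁻¹ i H with F a constant multiple of f(ξ(x)). The chain
rule then makes each Vekua component a nonzero multiple of one Maxwell equation
(`maxwell_vekua_algebra`). -/

noncomputable section

open Bicomplex Filter Topology

/-! ### Differentiation of functions of two variables and of parametric integrals -/

section Calculus

variable {E : Type*} [NormedAddCommGroup E] [NormedSpace ℝ E]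

/-- The linear map `(x, y) ↦ x v + y w`. -/
def planeMap (v w : E) : ℝ × ℝ →L[ℝ] E :=
  ((1 : ℝ →L[ℝ] ℝ).smulRight v).coprod ((1 : ℝ →L[ℝ] ℝ).smulRight w)

@[simp]
theorem planeMap_apply (v w : E) (p : ℝ × ℝ) : planeMap v w p = p.1 • v + p.2 • w := by
  simp [planeMap]

theorem Continuous.planeMap {X : Type*} [TopologicalSpace X] {v w : X → E} (hv : Continuous v)
    (hw : Continuous w) : Continuous fun x => planeMap (v x) (w x) := by
  have h : ∀ x, _root_.planeMap (v x) (w x) =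
      (ContinuousLinearMap.fst ℝ ℝ ℝ).smulRight (v x) +
        (ContinuousLinearMap.snd ℝ ℝ ℝ).smulRight (w x) := fun x => by
    ext <;> simp
  simp_rw [h]
  exact ((ContinuousLinearMap.smulRightL ℝ (ℝ × ℝ) E _).continuous.comp hv).add
    ((ContinuousLinearMap.smulRightL ℝ (ℝ × ℝ) E _).continuous.comp hw)

/-- A function of two real variables with continuous partial derivatives is differentiable. -/
theorem hasFDerivAt_of_continuous_partials {F F₁ F₂ : ℝ × ℝ → E}
    (h₁ : ∀ p : ℝ × ℝ, HasDerivAt (fun x => F (x, p.2)) (F₁ p) p.1)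
    (h₂ : ∀ p : ℝ × ℝ, HasDerivAt (fun y => F (p.1, y)) (F₂ p) p.2)
    (c₁ : Continuous F₁) (c₂ : Continuous F₂) (p : ℝ × ℝ) :
    HasFDerivAt F (planeMap (F₁ p) (F₂ p)) p := by
  have key := hasStrictFDerivAt_uncurry_coprod (𝕜 := ℝ) (u := p) (f := fun x y => F (x, y))
    (f₁ := fun x y => (1 : ℝ →L[ℝ] ℝ).smulRight (F₁ (x, y)))
    (f₂ := fun x y => (1 : ℝ →L[ℝ] ℝ).smulRight (F₂ (x, y)))
    (Eventually.of_forall fun v => (h₁ v).hasFDerivAt)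
    (Eventually.of_forall fun v => (h₂ v).hasFDerivAt)
    ((ContinuousLinearMap.smulRightL ℝ ℝ E 1).continuous.comp c₁).continuousAt
    ((ContinuousLinearMap.smulRightL ℝ ℝ E 1).continuous.comp c₂).continuousAt
  exact key.hasFDerivAt

theorem contDiff_of_continuous_partials {F F₁ F₂ : ℝ × ℝ → E}
    (h₁ : ∀ p : ℝ × ℝ, HasDerivAt (fun x => F (x, p.2)) (F₁ p) p.1)
    (h₂ : ∀ p : ℝ × ℝ, HasDerivAt (fun y => F (p.1, y)) (F₂ p) p.2)
    (c₁ : Continuous F₁) (c₂ : Continuous F₂) : ContDiff ℝ 1 F :=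
  contDiff_one_iff_hasFDerivAt.2
    ⟨_, c₁.planeMap c₂, hasFDerivAt_of_continuous_partials h₁ h₂ c₁ c₂⟩

/-- Differentiation under the integral sign over a compact interval. -/
theorem hasDerivAt_integral_of_continuous {k k' : ℝ → ℝ → E} (hk : Continuous k.uncurry)
    (hk' : Continuous k'.uncurry) (h : ∀ x τ, HasDerivAt (fun x => k x τ) (k' x τ) x)
    (a b x : ℝ) :
    HasDerivAt (fun x => ∫ τ in a..b, k x τ) (∫ τ in a..b, k' x τ) x := by
  obtain ⟨B, hB⟩ := ((isCompact_closedBall x 1).prod (isCompact_uIcc (a := a) (b := b)))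
    |>.exists_bound_of_continuousOn hk'.continuousOn
  have c : ∀ y, Continuous (k y) := fun y => hk.comp (by fun_prop : Continuous fun t : ℝ => (y, t))
  have c' : ∀ y, Continuous (k' y) :=
    fun y => hk'.comp (by fun_prop : Continuous fun t : ℝ => (y, t))
  refine (intervalIntegral.hasDerivAt_integral_of_dominated_loc_of_deriv_le (F := k) (F' := k')
    (bound := fun _ => B) (Metric.closedBall_mem_nhds x one_pos)
    (Eventually.of_forall fun y => (c y).aestronglyMeasurable)
    ((c x).intervalIntegrable _ _) (c' x).aestronglyMeasurable ?_ (by simp) ?_).2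
  · exact Eventually.of_forall fun t ht y hy => hB (y, t) ⟨hy, uIoc_subset_uIcc ht⟩
  · exact Eventually.of_forall fun t _ y _ => h y t

/-- The gain is the factor 1 / l: with l large, integration from 0 is a small operator in the norm
weighted by exp(-l |x|). Both existence and uniqueness below rest on it. -/
theorem norm_integral_le_exp {k : ℝ → E} {C l x : ℝ} (hl : 0 < l) (hC : 0 ≤ C)
    (h : ∀ s ∈ uIcc 0 x, ‖k s‖ ≤ C * Real.exp (l * |s|)) :
    ‖∫ s in (0 : ℝ)..x, k s‖ ≤ C * Real.exp (l * |x|) / l := by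
  have h1 : ‖∫ s in (0 : ℝ)..x, k s‖ ≤ |∫ s in (0 : ℝ)..x, C * Real.exp (l * |s|)| := by
    refine intervalIntegral.norm_integral_le_abs_of_norm_le ?_
      ((by fun_prop : Continuous fun s : ℝ => C * Real.exp (l * |s|)).intervalIntegrable _ _)
    exact (ae_restrict_iff' measurableSet_uIoc).2
      (Eventually.of_forall fun s hs => h s (uIoc_subset_uIcc hs))
  have key : ∀ y : ℝ, 0 ≤ y → ∫ s in (0 : ℝ)..y, C * Real.exp (l * |s|) =
      C * (Real.exp (l * y) - 1) / l := by
    intro y hy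
    rw [intervalIntegral.integral_congr (g := fun s => C * Real.exp (l * s))]
    · rw [intervalIntegral.integral_const_mul, intervalIntegral.integral_comp_mul_left _ hl.ne',
        integral_exp]
      simp
      ring
    · intro s hs
      rw [uIcc_of_le hy] at hs
      simp [abs_of_nonneg hs.1]
  have h2 : |∫ s in (0 : ℝ)..x, C * Real.exp (l * |s|)| =
      |∫ s in (0 : ℝ)..|x|, C * Real.exp (l * |s|)| := by
    rcases le_total 0 x with hx | hx
    · rw [abs_of_nonneg hx]
    · have := intervalIntegral.integral_comp_neg (a := 0) (b := -x)
        (fun s => C * Real.exp (l * |s|))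
      simp only [abs_neg, neg_neg, neg_zero] at this
      rw [abs_of_nonpos hx, this, intervalIntegral.integral_symm, abs_neg]
  rw [h2, key _ (abs_nonneg x)] at h1
  refine h1.trans ?_
  have : 1 ≤ Real.exp (l * |x|) := Real.one_le_exp (by positivity)
  rw [abs_of_nonneg (by apply div_nonneg (mul_nonneg hC (by linarith)) hl.le)]
  gcongr
  linarith

end Calculus

/-! ### Intervals of any type: compact pieces and extension of C¹ functions -/

section Intervals

variable {I : Set ℝ}

theorem interior_nonempty_of_nontrivial (hI : I.OrdConnected) (hn : I.Nontrivial) :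
    (interior I).Nonempty := by
  obtain ⟨x, hx, y, hy, hxy⟩ := hn.exists_lt
  exact ⟨(x + y) / 2, interior_mono (Ioo_subset_Icc_self.trans (hI.out hx hy))
    (by rw [isOpen_Ioo.interior_eq]; constructor <;> linarith)⟩

theorem interval_uniqueDiffOn (hI : I.OrdConnected) (hn : I.Nontrivial) : UniqueDiffOn ℝ I :=
  uniqueDiffOn_convex hI.convex (interior_nonempty_of_nontrivial hI hn)

/-- Any two points of an interval lie in a compact subinterval that is a neighbourhood of the
first one. -/
theorem exists_compact_interval_nhdsWithin (hI : I.OrdConnected) {x y : ℝ} (hx : x ∈ I)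
    (hy : y ∈ I) : ∃ α β, Icc α β ⊆ I ∧ x ∈ Icc α β ∧ y ∈ Icc α β ∧ Icc α β ∈ 𝓝[I] x := by
  obtain ⟨β, hβ, hxβ, hyβ, hβ'⟩ : ∃ β ∈ I, x ≤ β ∧ y ≤ β ∧ Iic β ∈ 𝓝[I] x := by
    by_cases h : ∃ z ∈ I, x < z
    · obtain ⟨z, hz, hxz⟩ := h
      refine ⟨max z y, ?_, hxz.le.trans (le_max_left _ _), le_max_right _ _,
        mem_nhdsWithin_of_mem_nhds (Iic_mem_nhds (hxz.trans_le (le_max_left _ _)))⟩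
      rcases max_choice z y with h | h <;> rw [h] <;> assumption
    · push Not at h
      exact ⟨x, hx, le_rfl, h y hy, mem_of_superset self_mem_nhdsWithin h⟩
  obtain ⟨α, hα, hxα, hyα, hα'⟩ : ∃ α ∈ I, α ≤ x ∧ α ≤ y ∧ Ici α ∈ 𝓝[I] x := by
    by_cases h : ∃ z ∈ I, z < x
    · obtain ⟨z, hz, hxz⟩ := h
      refine ⟨min z y, ?_, (min_le_left _ _).trans hxz.le, min_le_right _ _,
        mem_nhdsWithin_of_mem_nhds (Ici_mem_nhds ((min_le_left _ _).trans_lt hxz))⟩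
      rcases min_choice z y with h | h <;> rw [h] <;> assumption
    · push Not at h
      exact ⟨x, hx, le_rfl, h y hy, mem_of_superset self_mem_nhdsWithin h⟩
  exact ⟨α, β, hI.out hα hβ, ⟨hxα, hxβ⟩, ⟨hyα, hyβ⟩, inter_mem hα' hβ'⟩

variable {E : Type*} [NormedAddCommGroup E] [NormedSpace ℝ E] [CompleteSpace E]

/-- A `C¹` function on an interval agrees on each compact subinterval with a bounded `C¹` function
on the line. -/
theorem exists_contDiff_extension (hI : I.OrdConnected) (hn : I.Nontrivial) {F : ℝ → E}
    (hF : ContDiffOn ℝ 1 F I) {α β : ℝ} (hαβ : α ≤ β) (hsub : Icc α β ⊆ I) :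
    ∃ G : ℝ → E, ContDiff ℝ 1 G ∧ (∃ B, ∀ x, ‖G x‖ ≤ B) ∧
      ∀ x ∈ Icc α β, G x = F x ∧ deriv G x = derivWithin F I x := by
  have hu := interval_uniqueDiffOn hI hn
  set c : ℝ → ℝ := fun s => max α (min β s) with hc
  have cc : Continuous c := by fun_prop
  have cmem : ∀ s, c s ∈ Icc α β := fun s => ⟨le_max_left _ _, max_le hαβ (min_le_left _ _)⟩
  have ceq : ∀ s ∈ Icc α β, c s = s := fun s hs => by
    rw [hc]; simp only; rw [min_eq_right hs.2, max_eq_right hs.1]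
  -- The derivative is frozen at its endpoint value outside the compact interval and faded out over
  -- unit length. Compact support of `k` makes its primitive bounded, which the global contraction
  -- argument requires.
  set k : ℝ → E := fun s => (max 0 (1 - |s - c s|)) • derivWithin F I (c s) with hk
  have hkc : Continuous k := by
    refine (by fun_prop : Continuous fun s => max 0 (1 - |s - c s|)).smul ?_
    exact (hF.continuousOn_derivWithin hu le_rfl).comp_continuous cc fun s => hsub (cmem s)
  have hkeq : ∀ s ∈ Icc α β, k s = derivWithin F I s := fun s hs => by
    simp [hk, ceq s hs]
  have hks : HasCompactSupport k := by
    refine HasCompactSupport.of_support_subset_isCompact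
      (isCompact_Icc (a := α - 1) (b := β + 1)) fun s hs => ?_
    by_contra hs'
    refine hs ?_
    have : max 0 (1 - |s - c s|) = 0 := by
      refine max_eq_left ?_
      rw [mem_Icc, not_and_or, not_le, not_le] at hs'
      have := cmem s
      rcases hs' with h | h
      · linarith [neg_le_abs (s - c s), this.1]
      · linarith [le_abs_self (s - c s), this.2]
    simp [hk, this]
  have hki : Integrable k := hkc.integrable_of_hasCompactSupport hks
  set G : ℝ → E := fun x => F α + ∫ s in α..x, k s with hG
  have hGd : ∀ x, HasDerivAt G (k x) x := fun x =>
    (intervalIntegral.integral_hasDerivAt_right (hkc.intervalIntegrable _ _)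
      (hkc.stronglyMeasurableAtFilter _ _) hkc.continuousAt).const_add _
  refine ⟨G, ?_, ⟨‖F α‖ + ∫ s, ‖k s‖, fun x => ?_⟩, fun x hx => ⟨?_, ?_⟩⟩
  · rw [contDiff_one_iff_deriv]
    refine ⟨fun x => (hGd x).differentiableAt, ?_⟩
    rwa [show deriv G = k from funext fun x => (hGd x).deriv]
  · refine (norm_add_le _ _).trans (add_le_add_right ?_ _)
    refine intervalIntegral.norm_integral_le_integral_norm_uIoc.trans ?_
    exact setIntegral_le_integral hki.norm (Eventually.of_forall fun _ => norm_nonneg _)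
  · have : ∫ s in α..x, k s = F x - F α := by
      refine intervalIntegral.integral_eq_sub_of_hasDeriv_right_of_le hx.1
        (hF.continuousOn.mono ((Icc_subset_Icc le_rfl hx.2).trans hsub)) (fun s hs => ?_)
        (hkc.intervalIntegrable _ _)
      have hs' : s ∈ Icc α β := ⟨hs.1.le, hs.2.le.trans hx.2⟩
      have hnhds : I ∈ 𝓝 s :=
        mem_of_superset (Icc_mem_nhds hs.1 (hs.2.trans_le hx.2)) hsub
      rw [hkeq s hs']
      exact (((hF.differentiableOn one_ne_zero s (hsub hs')).hasDerivWithinAt).hasDerivAt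
        hnhds).hasDerivWithinAt
    simp [hG, this]
  · rw [(hGd x).deriv, hkeq x hx]

end Intervals

/-! ### The first order Goursat system and the pair of kernels it generates -/

section GoursatSystem

open scoped BoundedContinuousFunction

/-- The integral operator `m ↦ ∫₀ᵃ p(α + b) m(α, b) dα`, conjugated by the weight
`exp (l |a|)`, is a contraction if `l` is large. -/
theorem exists_weighted_volterra {p : ℝ → ℝ} (hp : Continuous p) {B : ℝ} (hB : ∀ x, ‖p x‖ ≤ B)
    {l : ℝ} (hl : 0 < l) (hlB : 2 * B ≤ l) :
    ∃ A : (ℝ × ℝ →ᵇ ℝ) → (ℝ × ℝ →ᵇ ℝ),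
      (∀ m a b, A m (a, b) = Real.exp (-(l * |a|)) *
        ∫ α in (0 : ℝ)..a, p (α + b) * (Real.exp (l * |α|) * m (α, b))) ∧
      ∀ m m', dist (A m) (A m') ≤ 1 / 2 * dist m m' := by
  have hB0 : 0 ≤ B := (norm_nonneg _).trans (hB 0)
  have cont : ∀ m : ℝ × ℝ →ᵇ ℝ, Continuous fun q : ℝ × ℝ => Real.exp (-(l * |q.1|)) *
      ∫ α in (0 : ℝ)..q.1, p (α + q.2) * (Real.exp (l * |α|) * m (α, q.2)) := by
    intro m
    refine Continuous.mul (by fun_prop) ?_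
    exact intervalIntegral.continuous_parametric_intervalIntegral_of_continuous
      (f := fun (q : ℝ × ℝ) α => p (α + q.2) * (Real.exp (l * |α|) * m (α, q.2)))
      (by unfold Function.uncurry; fun_prop) continuous_fst
  have bound : ∀ (C : ℝ) (m : ℝ × ℝ → ℝ), 0 ≤ C → (∀ q, ‖m q‖ ≤ C) → ∀ q : ℝ × ℝ,
      ‖Real.exp (-(l * |q.1|)) *
        ∫ α in (0 : ℝ)..q.1, p (α + q.2) * (Real.exp (l * |α|) * m (α, q.2))‖ ≤ 1 / 2 * C := by
    intro C m hC hm q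
    have h1 := norm_integral_le_exp (x := q.1) (C := B * C)
      (k := fun α => p (α + q.2) * (Real.exp (l * |α|) * m (α, q.2))) hl (by positivity)
      (fun s _ => by
        rw [norm_mul, norm_mul, Real.norm_of_nonneg (Real.exp_pos _).le,
          mul_comm (Real.exp _), ← mul_assoc]
        gcongr
        · exact hB _
        · exact hm _)
    rw [norm_mul, Real.norm_of_nonneg (Real.exp_pos _).le]
    calc _ ≤ Real.exp (-(l * |q.1|)) * (B * C * Real.exp (l * |q.1|) / l) := by gcongr
      _ = B / l * C := by
        rw [Real.exp_neg]
        field_simp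
      _ ≤ 1 / 2 * C := by
        refine mul_le_mul_of_nonneg_right ?_ hC
        rw [div_le_div_iff₀ hl two_pos]
        linarith
  refine ⟨fun m => BoundedContinuousFunction.ofNormedAddCommGroup _ (cont m) _
    (bound ‖m‖ m (norm_nonneg _) m.norm_coe_le_norm), fun m a b => rfl, fun m m' => ?_⟩
  refine (BoundedContinuousFunction.dist_le (by positivity)).2 fun q => ?_
  have h := bound (dist m m') (fun q => m q - m' q) dist_nonneg
    (fun q => by rw [← dist_eq_norm]; exact BoundedContinuousFunction.dist_coe_le_dist q) q
  rw [dist_eq_norm]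
  refine le_of_eq_of_le ?_ h
  simp only [BoundedContinuousFunction.coe_ofNormedAddCommGroup]
  rw [← mul_sub, ← intervalIntegral.integral_sub]
  · simp only [mul_sub]
  · exact Continuous.intervalIntegrable (by fun_prop) _ _
  · exact Continuous.intervalIntegrable (by fun_prop) _ _

/-- Solvability on the plane of the first order system `P_a = p(a + b) M`, `M_b = p(a + b) P`,
`P(0, b) = 0`, `M(a, 0) = p(a)`. -/
theorem exists_goursat_system {p : ℝ → ℝ} (hp : Continuous p) {B : ℝ} (hB : ∀ x, ‖p x‖ ≤ B) :
    ∃ P M : ℝ × ℝ → ℝ, Continuous P ∧ Continuous M ∧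
      (∀ q, P q = ∫ α in (0 : ℝ)..q.1, p (α + q.2) * M (α, q.2)) ∧
      ∀ q, M q = p q.1 + ∫ β in (0 : ℝ)..q.2, p (q.1 + β) * P (q.1, β) := by
  have hB0 : 0 ≤ B := (norm_nonneg _).trans (hB 0)
  -- Here 2B makes the Volterra operator halve distances; the summand 1 keeps `l` positive when B =
  -- 0.
  set l : ℝ := 2 * B + 1 with hl
  have hl0 : 0 < l := by positivity
  obtain ⟨A, hA, hAd⟩ := exists_weighted_volterra hp hB hl0 (by linarith)
  -- Conjugation by the swap lets the operator `A`, which integrates in the first variable, also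
  -- integrate in the second one.
  let sw : C(ℝ × ℝ, ℝ × ℝ) := ⟨Prod.swap, continuous_swap⟩
  have hsw : ∀ m m' : ℝ × ℝ →ᵇ ℝ, dist (m.compContinuous sw) (m'.compContinuous sw) ≤
      dist m m' := fun m m' =>
    (BoundedContinuousFunction.dist_le dist_nonneg).2 fun q =>
      BoundedContinuousFunction.dist_coe_le_dist (sw q)
  let g : ℝ × ℝ →ᵇ ℝ := BoundedContinuousFunction.ofNormedAddCommGroup
    (fun q : ℝ × ℝ => Real.exp (-(l * |q.1|)) * Real.exp (-(l * |q.2|)) * p q.1) (by fun_prop) B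
    (fun q => by
      rw [norm_mul]
      refine (mul_le_mul_of_nonneg_left (hB _) (norm_nonneg _)).trans
        (mul_le_of_le_one_left hB0 ?_)
      rw [← Real.exp_add, Real.norm_of_nonneg (Real.exp_pos _).le, Real.exp_le_one_iff]
      have := mul_nonneg hl0.le (abs_nonneg q.1)
      have := mul_nonneg hl0.le (abs_nonneg q.2)
      linarith)
  -- P is eliminated: the unknown `m` stands for exp(-l(|a| + |b|)) M, `A m` for P with the same
  -- weight, and `g` for the weighted boundary term p(a).
  let T : (ℝ × ℝ →ᵇ ℝ) → (ℝ × ℝ →ᵇ ℝ) := fun m =>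
    g + (A ((A m).compContinuous sw)).compContinuous sw
  have hT : ContractingWith (1 / 2) T := by
    refine ⟨by rw [← NNReal.coe_lt_coe]; norm_num, LipschitzWith.of_dist_le_mul fun m m' => ?_⟩
    simp only [T, dist_add_left]
    refine (hsw _ _).trans ((hAd _ _).trans ?_)
    have h1 := (hsw (A m) (A m')).trans (hAd m m')
    have h0 : 0 ≤ dist m m' := dist_nonneg
    simp only [NNReal.coe_div, NNReal.coe_one, NNReal.coe_ofNat]
    linarith
  let m := hT.fixedPoint
  have hm : T m = m := hT.fixedPoint_isFixedPt
  have e : ∀ x : ℝ, Real.exp (l * |x|) * Real.exp (-(l * |x|)) = 1 := fun x => by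
    rw [← Real.exp_add]; simp
  have hM : ∀ q : ℝ × ℝ, m q = Real.exp (-(l * |q.1|)) * Real.exp (-(l * |q.2|)) * p q.1 +
      Real.exp (-(l * |q.2|)) * ∫ β in (0 : ℝ)..q.2, p (β + q.1) *
        (Real.exp (l * |β|) * A m (q.1, β)) := fun q => by
    conv_lhs => rw [← hm]
    change g q + A _ (q.2, q.1) = _
    rw [hA]
    rfl
  refine ⟨fun q => Real.exp (l * |q.1|) * Real.exp (l * |q.2|) * A m q,
    fun q => Real.exp (l * |q.1|) * Real.exp (l * |q.2|) * m q, by fun_prop, by fun_prop,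
    fun q => ?_, fun q => ?_⟩
  · obtain ⟨a, b⟩ := q
    simp only
    rw [hA]
    calc _ = Real.exp (l * |a|) * Real.exp (-(l * |a|)) * (Real.exp (l * |b|) *
          ∫ α in (0 : ℝ)..a, p (α + b) * (Real.exp (l * |α|) * m (α, b))) := by ring
      _ = _ := by
        rw [e, one_mul, ← intervalIntegral.integral_const_mul]
        congr 1; ext α; ring
  · obtain ⟨a, b⟩ := q
    simp only
    rw [hM]
    calc _ = Real.exp (l * |a|) * Real.exp (-(l * |a|)) *
          (Real.exp (l * |b|) * Real.exp (-(l * |b|))) * p a +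
          Real.exp (l * |b|) * Real.exp (-(l * |b|)) * (Real.exp (l * |a|) *
          ∫ β in (0 : ℝ)..b, p (β + a) * (Real.exp (l * |β|) * A m (a, β))) := by ring
      _ = _ := by
        rw [e, e, one_mul, one_mul, one_mul, ← intervalIntegral.integral_const_mul]
        congr 2; ext β; rw [add_comm β a]; ring

/-- `P`, `M` solve the system `P_a = p(a + b) M`, `M_b = p(a + b) P`, `P(0, b) = 0`,
`M(a, 0) = p(a)` on the plane. -/
structure IsGoursatSystem (p : ℝ → ℝ) (P M : ℝ × ℝ → ℝ) : Prop where
  continuous_fst : Continuous P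
  continuous_snd : Continuous M
  fst_eq : ∀ q, P q = ∫ α in (0 : ℝ)..q.1, p (α + q.2) * M (α, q.2)
  snd_eq : ∀ q, M q = p q.1 + ∫ β in (0 : ℝ)..q.2, p (q.1 + β) * P (q.1, β)

namespace IsGoursatSystem

variable {p : ℝ → ℝ} {P M : ℝ × ℝ → ℝ}

/-- This symmetry exchanges K = (P + M)/2 and L = (P - M)/2, so one solution of the system serves f
and 1/f together. -/
theorem neg (h : IsGoursatSystem p P M) :
    IsGoursatSystem (fun x => -p x) P (fun q => -M q) where
  continuous_fst := h.continuous_fst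
  continuous_snd := h.continuous_snd.neg
  fst_eq q := by simpa using h.fst_eq q
  snd_eq q := by
    rw [h.snd_eq q]
    simp only [neg_mul, intervalIntegral.integral_neg]
    ring

theorem fst_zero (h : IsGoursatSystem p P M) (b : ℝ) : P (0, b) = 0 := by
  rw [h.fst_eq]; simp

theorem snd_zero (h : IsGoursatSystem p P M) (a : ℝ) : M (a, 0) = p a := by
  rw [h.snd_eq]; simp

theorem hasDerivAt_fst_fst (h : IsGoursatSystem p P M) (hp : Continuous p) (q : ℝ × ℝ) :
    HasDerivAt (fun a => P (a, q.2)) (p (q.1 + q.2) * M q) q.1 := by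
  have c : Continuous fun α => p (α + q.2) * M (α, q.2) := by
    have := h.continuous_snd
    fun_prop
  simp_rw [h.fst_eq]
  exact intervalIntegral.integral_hasDerivAt_right (c.intervalIntegrable _ _)
    (c.stronglyMeasurableAtFilter _ _) c.continuousAt

theorem hasDerivAt_snd_snd (h : IsGoursatSystem p P M) (hp : Continuous p) (q : ℝ × ℝ) :
    HasDerivAt (fun b => M (q.1, b)) (p (q.1 + q.2) * P q) q.2 := by
  have c : Continuous fun β => p (q.1 + β) * P (q.1, β) := by
    have := h.continuous_fst
    fun_prop
  simp_rw [h.snd_eq]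
  exact (intervalIntegral.integral_hasDerivAt_right (c.intervalIntegrable _ _)
    (c.stronglyMeasurableAtFilter _ _) c.continuousAt).const_add _

/-- The transversal derivative comes from differentiating the integral equation for P under the
integral sign, where M_b = p P is already known. Only p' appears, never a derivative of f''/f. -/
theorem hasDerivAt_fst_snd (h : IsGoursatSystem p P M) (hp : ContDiff ℝ 1 p) (q : ℝ × ℝ) :
    HasDerivAt (fun b => P (q.1, b)) (∫ α in (0 : ℝ)..q.1,
      (deriv p (α + q.2) * M (α, q.2) + p (α + q.2) * (p (α + q.2) * P (α, q.2)))) q.2 := by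
  have hp' : Continuous (deriv p) := hp.continuous_deriv le_rfl
  have c := hp.continuous
  have cP := h.continuous_fst
  have cM := h.continuous_snd
  have key := hasDerivAt_integral_of_continuous (k := fun b α => p (α + b) * M (α, b))
    (k' := fun b α => deriv p (α + b) * M (α, b) + p (α + b) * (p (α + b) * P (α, b)))
    (by unfold Function.uncurry; fun_prop) (by unfold Function.uncurry; fun_prop)
    (fun b α => (((hp.differentiable one_ne_zero _).hasDerivAt).comp_const_add α b).mul
      (h.hasDerivAt_snd_snd c (α, b))) 0 q.1 q.2
  simp_rw [h.fst_eq (q.1, _)]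
  exact key

theorem hasDerivAt_snd_fst (h : IsGoursatSystem p P M) (hp : ContDiff ℝ 1 p) (q : ℝ × ℝ) :
    HasDerivAt (fun a => M (a, q.2)) (deriv p q.1 + ∫ β in (0 : ℝ)..q.2,
      (deriv p (q.1 + β) * P (q.1, β) + p (q.1 + β) * (p (q.1 + β) * M (q.1, β)))) q.1 := by
  have hp' : Continuous (deriv p) := hp.continuous_deriv le_rfl
  have c := hp.continuous
  have cP := h.continuous_fst
  have cM := h.continuous_snd
  have key := hasDerivAt_integral_of_continuous (k := fun a β => p (a + β) * P (a, β))
    (k' := fun a β => deriv p (a + β) * P (a, β) + p (a + β) * (p (a + β) * M (a, β)))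
    (by unfold Function.uncurry; fun_prop) (by unfold Function.uncurry; fun_prop)
    (fun a β => (((hp.differentiable one_ne_zero _).hasDerivAt).comp_add_const a β).mul
      (h.hasDerivAt_fst_fst c (a, β))) 0 q.2 q.1
  simp_rw [h.snd_eq (_, q.2)]
  exact ((hp.differentiable one_ne_zero _).hasDerivAt).add key

theorem contDiff_fst (h : IsGoursatSystem p P M) (hp : ContDiff ℝ 1 p) : ContDiff ℝ 1 P := by
  have hp' : Continuous (deriv p) := hp.continuous_deriv le_rfl
  have c := hp.continuous
  have cP := h.continuous_fst
  have cM := h.continuous_snd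
  refine contDiff_of_continuous_partials (h.hasDerivAt_fst_fst c) (h.hasDerivAt_fst_snd hp)
    (by fun_prop) ?_
  exact intervalIntegral.continuous_parametric_intervalIntegral_of_continuous
    (f := fun (q : ℝ × ℝ) α => deriv p (α + q.2) * M (α, q.2) +
      p (α + q.2) * (p (α + q.2) * P (α, q.2)))
    (by unfold Function.uncurry; fun_prop) _root_.continuous_fst

theorem contDiff_snd (h : IsGoursatSystem p P M) (hp : ContDiff ℝ 1 p) : ContDiff ℝ 1 M := by
  have hp' : Continuous (deriv p) := hp.continuous_deriv le_rfl
  have c := hp.continuous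
  have cP := h.continuous_fst
  have cM := h.continuous_snd
  refine contDiff_of_continuous_partials (h.hasDerivAt_snd_fst hp) (h.hasDerivAt_snd_snd c)
    ?_ (by fun_prop)
  refine Continuous.add (by fun_prop) ?_
  exact intervalIntegral.continuous_parametric_intervalIntegral_of_continuous
    (f := fun (q : ℝ × ℝ) β => deriv p (q.1 + β) * P (q.1, β) +
      p (q.1 + β) * (p (q.1 + β) * M (q.1, β)))
    (by unfold Function.uncurry; fun_prop) _root_.continuous_snd

/-- The half sum of the unknowns of the system solves the second order Goursat problem with the
potential `p' + p²`. -/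
theorem goursat (h : IsGoursatSystem p P M) (hp : ContDiff ℝ 1 p) (a b : ℝ) :
    (P (a, b) + M (a, b)) / 2 = p 0 / 2 +
      (1 / 2) * (∫ s in (0 : ℝ)..a, (deriv p s + p s ^ 2)) +
      ∫ α in (0 : ℝ)..a, ∫ β in (0 : ℝ)..b,
        (deriv p (α + β) + p (α + β) ^ 2) * ((P (α, β) + M (α, β)) / 2) := by
  have hp' : Continuous (deriv p) := hp.continuous_deriv le_rfl
  have c := hp.continuous
  have cP := h.continuous_fst
  have cM := h.continuous_snd
  -- The fundamental theorem in β, started at M(α, 0) = p(α). The boundary term p(α)² completes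
  -- p'(α) to the potential p' + p².
  have ftc : ∀ α, p (α + b) * M (α, b) = p α ^ 2 + ∫ β in (0 : ℝ)..b,
      (deriv p (α + β) * M (α, β) + p (α + β) * (p (α + β) * P (α, β))) := fun α => by
    have := intervalIntegral.integral_eq_sub_of_hasDerivAt (a := 0) (b := b)
      (f := fun β => p (α + β) * M (α, β))
      (f' := fun β => deriv p (α + β) * M (α, β) + p (α + β) * (p (α + β) * P (α, β)))
      (fun β _ => (((hp.differentiable one_ne_zero _).hasDerivAt).comp_const_add α β).mul
        (h.hasDerivAt_snd_snd c (α, β)))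
      (Continuous.intervalIntegrable (by fun_prop) _ _)
    rw [this, h.snd_zero]
    simp
    ring
  have cint : Continuous fun α => ∫ β in (0 : ℝ)..b,
      (deriv p (α + β) + p (α + β) ^ 2) * ((P (α, β) + M (α, β)) / 2) :=
    intervalIntegral.continuous_parametric_intervalIntegral_of_continuous'
      (by unfold Function.uncurry; fun_prop) _ _
  have hd : ∀ α, HasDerivAt (fun α => (P (α, b) + M (α, b)) / 2)
      ((1 / 2) * (deriv p α + p α ^ 2) + ∫ β in (0 : ℝ)..b,
        (deriv p (α + β) + p (α + β) ^ 2) * ((P (α, β) + M (α, β)) / 2)) α := fun α => by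
    have := ((h.hasDerivAt_fst_fst c (α, b)).add (h.hasDerivAt_snd_fst hp (α, b))).div_const 2
    refine this.congr_deriv ?_
    simp only
    rw [ftc]
    have e : ∫ β in (0 : ℝ)..b,
        (deriv p (α + β) + p (α + β) ^ 2) * ((P (α, β) + M (α, β)) / 2) =
        ((∫ β in (0 : ℝ)..b,
          (deriv p (α + β) * M (α, β) + p (α + β) * (p (α + β) * P (α, β)))) +
        ∫ β in (0 : ℝ)..b,
          (deriv p (α + β) * P (α, β) + p (α + β) * (p (α + β) * M (α, β)))) / 2 := by
      rw [← intervalIntegral.integral_add (Continuous.intervalIntegrable (by fun_prop) _ _)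
        (Continuous.intervalIntegrable (by fun_prop) _ _), ← intervalIntegral.integral_div]
      congr 1; ext β; ring
    rw [e]
    ring
  -- Integration in α from 0, where P vanishes and M(0, b) = p(0), produces the constant p(0)/2.
  have := intervalIntegral.integral_eq_sub_of_hasDerivAt (a := 0) (b := a) (fun α _ => hd α)
    (Continuous.intervalIntegrable (by fun_prop) _ _)
  rw [intervalIntegral.integral_add (Continuous.intervalIntegrable (by fun_prop) _ _)
    (cint.intervalIntegrable _ _), intervalIntegral.integral_const_mul, h.fst_zero] at this
  have h0 : M (0, b) = p 0 := by
    rw [h.snd_eq]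
    simp [h.fst_zero]
  rw [h0, zero_add] at this
  linarith

end IsGoursatSystem

/-- A pair of kernels intertwining `∂_ξ - p` and `∂_ξ + p` with `∂_τ`. -/
structure IsDarbouxPair (p : ℝ → ℝ) (K L : ℝ × ℝ → ℝ) : Prop where
  contDiff_fst : ContDiff ℝ 1 K
  contDiff_snd : ContDiff ℝ 1 L
  intertwine : ∀ z, fderiv ℝ K z (1, 0) + fderiv ℝ L z (0, 1) = p z.1 * K z
  diagonal : ∀ x, K (x, x) - L (x, x) = p x
  antidiagonal : ∀ x, K (x, -x) + L (x, -x) = 0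
  goursat : ∀ z, K z = p 0 / 2 +
    (1 / 2) * (∫ s in (0 : ℝ)..((z.1 + z.2) / 2), (deriv p s + p s ^ 2)) +
      ∫ a in (0 : ℝ)..((z.1 + z.2) / 2), ∫ b in (0 : ℝ)..((z.1 - z.2) / 2),
        (deriv p (a + b) + p (a + b) ^ 2) * K (a + b, a - b)

/-- The characteristic coordinates `((ξ + τ) / 2, (ξ - τ) / 2)`. -/
def charCoord (z : ℝ × ℝ) : ℝ × ℝ := ((z.1 + z.2) / 2, (z.1 - z.2) / 2)

theorem charCoord_add_sub (a b : ℝ) : charCoord (a + b, a - b) = (a, b) := by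
  simp [charCoord]

theorem hasFDerivAt_charCoord (z : ℝ × ℝ) :
    HasFDerivAt charCoord (planeMap ((1 / 2, 1 / 2) : ℝ × ℝ) (1 / 2, -1 / 2)) z := by
  have : charCoord = planeMap ((1 / 2, 1 / 2) : ℝ × ℝ) (1 / 2, -1 / 2) := by
    ext z <;> simp [charCoord] <;> ring
  rw [this]
  exact ContinuousLinearMap.hasFDerivAt _

/-- Since ∂_ξ = (∂_a + ∂_b)/2 and ∂_τ = (∂_a - ∂_b)/2, the sum K_ξ + L_τ reduces to (P_a + M_b)/2,
and the cross derivatives P_b, M_a cancel. The diagonal is b = 0 and the antidiagonal a = 0, where M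
and P are prescribed. -/
theorem IsGoursatSystem.isDarbouxPair {p : ℝ → ℝ} {P M : ℝ × ℝ → ℝ}
    (h : IsGoursatSystem p P M) (hp : ContDiff ℝ 1 p) :
    IsDarbouxPair p (fun z => (P (charCoord z) + M (charCoord z)) / 2)
      (fun z => (P (charCoord z) - M (charCoord z)) / 2) := by
  have hP := h.contDiff_fst hp
  have hM := h.contDiff_snd hp
  have hc : ContDiff ℝ 1 charCoord := by unfold charCoord; fun_prop
  have c := hp.continuous
  have dP : ∀ q, HasFDerivAt P (fderiv ℝ P q) q := fun q =>
    (hP.differentiable one_ne_zero q).hasFDerivAt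
  have dM : ∀ q, HasFDerivAt M (fderiv ℝ M q) q := fun q =>
    (hM.differentiable one_ne_zero q).hasFDerivAt
  have hPa : ∀ q : ℝ × ℝ, fderiv ℝ P q (1, 0) = p (q.1 + q.2) * M q := fun q =>
    ((dP q).comp_hasDerivAt q.1 (f := fun x => (x, q.2))
      ((hasDerivAt_id q.1).prodMk (hasDerivAt_const _ _))).unique (h.hasDerivAt_fst_fst c q)
  have hMb : ∀ q : ℝ × ℝ, fderiv ℝ M q (0, 1) = p (q.1 + q.2) * P q := fun q =>
    ((dM q).comp_hasDerivAt q.2 (f := fun x => (q.1, x))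
      ((hasDerivAt_const _ _).prodMk (hasDerivAt_id q.2))).unique (h.hasDerivAt_snd_snd c q)
  refine ⟨by fun_prop, by fun_prop, fun z => ?_, fun x => ?_, fun x => ?_, fun z => ?_⟩
  · have dPc := (dP (charCoord z)).comp z (hasFDerivAt_charCoord z)
    have dMc := (dM (charCoord z)).comp z (hasFDerivAt_charCoord z)
    have dK : HasFDerivAt (fun z => (P (charCoord z) + M (charCoord z)) / 2) _ z :=
      (dPc.add dMc).mul_const 2⁻¹
    have dL : HasFDerivAt (fun z => (P (charCoord z) - M (charCoord z)) / 2) _ z :=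
      (dPc.sub dMc).mul_const 2⁻¹
    rw [dK.fderiv, dL.fderiv]
    have e : (charCoord z).1 + (charCoord z).2 = z.1 := by simp [charCoord]; ring
    have hPa := hPa (charCoord z)
    have hMb := hMb (charCoord z)
    rw [e] at hPa hMb
    have s1 : ((1 / 2, 1 / 2) : ℝ × ℝ) = (1 / 2 : ℝ) • (1, 0) + (1 / 2 : ℝ) • (0, 1) := by
      ext <;> simp
    have s2 : ((1 / 2, -1 / 2) : ℝ × ℝ) = (1 / 2 : ℝ) • (1, 0) + (-1 / 2 : ℝ) • (0, 1) := by
      ext <;> simp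
    simp only [_root_.smul_apply, _root_.add_apply,
      _root_.sub_apply, ContinuousLinearMap.comp_apply, planeMap_apply, s1, s2,
      map_add, map_smul, smul_eq_mul, hPa, hMb]
    ring
  · simp only [charCoord, sub_self, zero_div, add_self_div_two, h.snd_zero]
    ring
  · simp only [charCoord, add_neg_cancel, zero_div, h.fst_zero]
    ring
  · simp only [charCoord_add_sub]
    exact h.goursat hp _ _

/-- For every bounded `C¹` function `p` there is a pair of kernels for `p` and `-p`. -/
theorem exists_isDarbouxPair {p : ℝ → ℝ} (hp : ContDiff ℝ 1 p) {B : ℝ} (hB : ∀ x, ‖p x‖ ≤ B) :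
    ∃ K L : ℝ × ℝ → ℝ, IsDarbouxPair p K L ∧ IsDarbouxPair (fun x => -p x) L K := by
  obtain ⟨P, M, cP, cM, hP, hM⟩ := exists_goursat_system hp.continuous hB
  have h : IsGoursatSystem p P M := ⟨cP, cM, hP, hM⟩
  have h' := h.neg.isDarbouxPair hp.neg
  refine ⟨_, _, h.isDarbouxPair hp, ?_⟩
  simpa only [← sub_eq_add_neg, sub_neg_eq_add] using h'

end GoursatSystem

/-! ### Uniqueness and gluing of Goursat kernels -/

section GoursatKernel

/-- Uniqueness for a Volterra equation on a rectangle, for data continuous on the plane. -/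
theorem volterra_unique_of_continuous {a₀ b₀ : ℝ} {Q d : ℝ × ℝ → ℝ} (hQ : Continuous Q)
    (hd : Continuous d)
    (h : ∀ z ∈ uIcc 0 a₀ ×ˢ uIcc 0 b₀,
      d z = ∫ α in (0 : ℝ)..z.1, ∫ β in (0 : ℝ)..z.2, Q (α, β) * d (α, β)) :
    ∀ z ∈ uIcc 0 a₀ ×ˢ uIcc 0 b₀, d z = 0 := by
  have hcomp : IsCompact (uIcc 0 a₀ ×ˢ uIcc 0 b₀) := isCompact_uIcc.prod isCompact_uIcc
  obtain ⟨B, hB⟩ := hcomp.exists_bound_of_continuousOn hQ.continuousOn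
  have hB0 : 0 ≤ B := (norm_nonneg _).trans (hB (0, 0) ⟨left_mem_uIcc, left_mem_uIcc⟩)
  -- With this `l` the maximum N of the weighted norm satisfies N ≤ (B |b₀| / l) N with a factor
  -- below 1, which forces N = 0.
  set l : ℝ := B * |b₀| + 1 with hl
  have hl0 : 0 < l := by positivity
  obtain ⟨z₁, hz₁, hmax⟩ := hcomp.exists_isMaxOn
    (f := fun z : ℝ × ℝ => Real.exp (-(l * |z.1|)) * ‖d z‖)
    ⟨(0, 0), left_mem_uIcc, left_mem_uIcc⟩ (by fun_prop)
  set N := Real.exp (-(l * |z₁.1|)) * ‖d z₁‖ with hN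
  have hN0 : 0 ≤ N := by positivity
  have hle : ∀ z ∈ uIcc 0 a₀ ×ˢ uIcc 0 b₀, ‖d z‖ ≤ N * Real.exp (l * |z.1|) := fun z hz => by
    have := hmax hz
    simp only [mem_ofPred_eq] at this
    calc ‖d z‖ = Real.exp (-(l * |z.1|)) * ‖d z‖ * Real.exp (l * |z.1|) := by
          rw [Real.exp_neg]; field_simp
      _ ≤ _ := by gcongr
  have hb₁ : |z₁.2| ≤ |b₀| := by simpa using abs_sub_left_of_mem_uIcc hz₁.2
  have hest : ‖d z₁‖ ≤ B * N * |b₀| * Real.exp (l * |z₁.1|) / l := by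
    rw [h z₁ hz₁]
    refine norm_integral_le_exp hl0 (by positivity) fun α hα => ?_
    have hα' : α ∈ uIcc 0 a₀ := uIcc_subset_uIcc left_mem_uIcc hz₁.1 hα
    have := intervalIntegral.norm_integral_le_of_norm_le_const (a := 0) (b := z₁.2)
      (f := fun β => Q (α, β) * d (α, β)) (C := B * (N * Real.exp (l * |α|))) fun β hβ => by
        have hz : (α, β) ∈ uIcc 0 a₀ ×ˢ uIcc 0 b₀ :=
          ⟨hα', uIcc_subset_uIcc left_mem_uIcc hz₁.2 (uIoc_subset_uIcc hβ)⟩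
        rw [norm_mul]
        exact mul_le_mul (hB _ hz) (hle _ hz) (norm_nonneg _) hB0
    rw [sub_zero] at this
    refine this.trans ?_
    calc _ ≤ B * (N * Real.exp (l * |α|)) * |b₀| := by gcongr
      _ = _ := by ring
  have hNle : N ≤ 0 := by
    have h2 : N ≤ B * |b₀| * N / l := by
      calc N ≤ Real.exp (-(l * |z₁.1|)) * (B * N * |b₀| * Real.exp (l * |z₁.1|) / l) := by
            rw [hN]; gcongr
        _ = _ := by rw [Real.exp_neg]; field_simp
    rw [le_div_iff₀ hl0, hl] at h2
    linarith
  intro z hz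
  have := hle z hz
  rw [le_antisymm hNle hN0, zero_mul] at this
  exact norm_le_zero_iff.1 this

theorem exists_continuous_eqOn_rectangle {a₀ b₀ : ℝ} {k : ℝ × ℝ → ℝ}
    (hk : ContinuousOn k (uIcc 0 a₀ ×ˢ uIcc 0 b₀)) :
    ∃ k', Continuous k' ∧ EqOn k' k (uIcc 0 a₀ ×ˢ uIcc 0 b₀) := by
  have mem : ∀ c x : ℝ, max (min 0 c) (min (max 0 c) x) ∈ uIcc 0 c := fun c x =>
    ⟨le_max_left _ _, max_le min_le_max (min_le_left _ _)⟩
  have eq : ∀ c x : ℝ, x ∈ uIcc 0 c → max (min 0 c) (min (max 0 c) x) = x := fun c x hx => by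
    rw [min_eq_right hx.2, max_eq_right hx.1]
  -- Both coordinates are clamped to the rectangle; the result is continuous on the plane and
  -- unchanged on the rectangle.
  refine ⟨fun z => k (max (min 0 a₀) (min (max 0 a₀) z.1), max (min 0 b₀) (min (max 0 b₀) z.2)),
    hk.comp_continuous (by fun_prop) fun z => ⟨mem _ _, mem _ _⟩, fun z hz => ?_⟩
  simp only [eq _ _ hz.1, eq _ _ hz.2]

theorem volterra_unique {a₀ b₀ : ℝ} {Q k₁ k₂ g : ℝ × ℝ → ℝ}
    (hQ : ContinuousOn Q (uIcc 0 a₀ ×ˢ uIcc 0 b₀)) (hk₁ : ContinuousOn k₁ (uIcc 0 a₀ ×ˢ uIcc 0 b₀))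
    (hk₂ : ContinuousOn k₂ (uIcc 0 a₀ ×ˢ uIcc 0 b₀))
    (h₁ : ∀ z ∈ uIcc 0 a₀ ×ˢ uIcc 0 b₀,
      k₁ z = g z + ∫ α in (0 : ℝ)..z.1, ∫ β in (0 : ℝ)..z.2, Q (α, β) * k₁ (α, β))
    (h₂ : ∀ z ∈ uIcc 0 a₀ ×ˢ uIcc 0 b₀,
      k₂ z = g z + ∫ α in (0 : ℝ)..z.1, ∫ β in (0 : ℝ)..z.2, Q (α, β) * k₂ (α, β)) :
    EqOn k₁ k₂ (uIcc 0 a₀ ×ˢ uIcc 0 b₀) := by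
  obtain ⟨Q', cQ, eQ⟩ := exists_continuous_eqOn_rectangle hQ
  obtain ⟨l₁, c₁, e₁⟩ := exists_continuous_eqOn_rectangle hk₁
  obtain ⟨l₂, c₂, e₂⟩ := exists_continuous_eqOn_rectangle hk₂
  have congr : ∀ {k l : ℝ × ℝ → ℝ}, EqOn l k (uIcc 0 a₀ ×ˢ uIcc 0 b₀) →
      ∀ z ∈ uIcc 0 a₀ ×ˢ uIcc 0 b₀,
      ∫ α in (0 : ℝ)..z.1, ∫ β in (0 : ℝ)..z.2, Q (α, β) * k (α, β) =
      ∫ α in (0 : ℝ)..z.1, ∫ β in (0 : ℝ)..z.2, Q' (α, β) * l (α, β) := by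
    intro k l e z hz
    refine intervalIntegral.integral_congr fun α hα => intervalIntegral.integral_congr
      fun β hβ => ?_
    have hm : (α, β) ∈ uIcc 0 a₀ ×ˢ uIcc 0 b₀ :=
      ⟨uIcc_subset_uIcc left_mem_uIcc hz.1 hα, uIcc_subset_uIcc left_mem_uIcc hz.2 hβ⟩
    simp only [eQ hm, e hm]
  have key := volterra_unique_of_continuous (a₀ := a₀) (b₀ := b₀) cQ
    (d := fun z => l₁ z - l₂ z) (c₁.sub c₂) fun z hz => by
    have i : ∀ {l : ℝ × ℝ → ℝ}, Continuous l → Continuous fun α =>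
        ∫ β in (0 : ℝ)..z.2, Q' (α, β) * l (α, β) := fun hl =>
      intervalIntegral.continuous_parametric_intervalIntegral_of_continuous'
        (by unfold Function.uncurry; fun_prop) _ _
    simp only [mul_sub]
    rw [e₁ hz, e₂ hz, h₁ z hz, h₂ z hz, congr e₁ z hz, congr e₂ z hz, add_sub_add_left_eq_sub,
      ← intervalIntegral.integral_sub ((i c₁).intervalIntegrable _ _)
        ((i c₂).intervalIntegrable _ _)]
    congr 1
    ext α
    rw [← intervalIntegral.integral_sub (Continuous.intervalIntegrable (by fun_prop) _ _)
        (Continuous.intervalIntegrable (by fun_prop) _ _)]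
  intro z hz
  have := key z hz
  rw [e₁ hz, e₂ hz] at this
  exact sub_eq_zero.1 this

theorem kernelDomain_mono {J J' : Set ℝ} (h : J ⊆ J') : kernelDomain J ⊆ kernelDomain J' :=
  fun _ hz => ⟨h hz.1, hz.2⟩

/-- Finite propagation: the rectangle of integration at (ξ, τ) involves only first coordinates
between 0 and ξ. Restriction to subintervals, uniqueness and gluing all depend on this. -/
theorem charRectangle_mem {z : ℝ × ℝ} (hz : |z.2| ≤ |z.1|) {a b : ℝ}
    (ha : a ∈ uIcc 0 ((z.1 + z.2) / 2)) (hb : b ∈ uIcc 0 ((z.1 - z.2) / 2)) :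
    (a + b, a - b) ∈ kernelDomain (uIcc 0 z.1) := by
  change a + b ∈ uIcc 0 z.1 ∧ |a - b| ≤ |a + b|
  rcases le_total 0 z.1 with h | h
  · rw [abs_of_nonneg h, abs_le] at hz
    rw [uIcc_of_le (by linarith)] at ha hb
    rw [uIcc_of_le h, abs_of_nonneg (add_nonneg ha.1 hb.1), abs_le]
    refine ⟨⟨?_, ?_⟩, ?_, ?_⟩ <;> linarith [ha.1, ha.2, hb.1, hb.2]
  · rw [abs_of_nonpos h, abs_le] at hz
    rw [uIcc_of_ge (by linarith)] at ha hb
    rw [uIcc_of_ge h, abs_of_nonpos (add_nonpos ha.2 hb.2), abs_le]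
    refine ⟨⟨?_, ?_⟩, ?_, ?_⟩ <;> linarith [ha.1, ha.2, hb.1, hb.2]

theorem half_add_mem_uIcc {z : ℝ × ℝ} (hz : |z.2| ≤ |z.1|) {s : ℝ}
    (hs : s ∈ uIcc 0 ((z.1 + z.2) / 2)) : s ∈ uIcc 0 z.1 := by
  simpa using (charRectangle_mem hz hs left_mem_uIcc).1

theorem uIcc_zero_subset {J : Set ℝ} (hJ : J.OrdConnected) (h0 : (0 : ℝ) ∈ J) {x : ℝ}
    (hx : x ∈ J) : uIcc 0 x ⊆ J := hJ.uIcc_subset h0 hx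

namespace IsGoursatKernel

variable {J J' : Set ℝ} {q q' : ℝ → ℝ} {h : ℝ} {K K₁ K₂ : ℝ × ℝ → ℝ}

theorem mono (hK : IsGoursatKernel J q h K) (hJ : J' ⊆ J) : IsGoursatKernel J' q h K :=
  ⟨hK.1.mono (kernelDomain_mono hJ), fun p hp => hK.2 p (kernelDomain_mono hJ hp)⟩

/-- In characteristic coordinates the integrated equation is a Volterra equation on the rectangle
with opposite corners 0 and `charCoord z`, so `volterra_unique` applies point by point. -/
theorem unique (hJ : J.OrdConnected) (h0 : (0 : ℝ) ∈ J) (hq : ContinuousOn q J)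
    (h₁ : IsGoursatKernel J q h K₁) (h₂ : IsGoursatKernel J q h K₂) :
    EqOn K₁ K₂ (kernelDomain J) := by
  intro z hz
  have hsub := uIcc_zero_subset hJ h0 hz.1
  have mem : ∀ w ∈ uIcc 0 ((z.1 + z.2) / 2) ×ˢ uIcc 0 ((z.1 - z.2) / 2),
      (w.1 + w.2, w.1 - w.2) ∈ kernelDomain J := fun w hw =>
    kernelDomain_mono hsub (charRectangle_mem hz.2 hw.1 hw.2)
  have cK : ∀ {K : ℝ × ℝ → ℝ}, ContinuousOn K (kernelDomain J) →
      ContinuousOn (fun w : ℝ × ℝ => K (w.1 + w.2, w.1 - w.2))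
        (uIcc 0 ((z.1 + z.2) / 2) ×ˢ uIcc 0 ((z.1 - z.2) / 2)) := fun hK =>
    hK.comp (by fun_prop) mem
  have e : ∀ {K : ℝ × ℝ → ℝ}, IsGoursatKernel J q h K →
      ∀ w ∈ uIcc 0 ((z.1 + z.2) / 2) ×ˢ uIcc 0 ((z.1 - z.2) / 2),
      K (w.1 + w.2, w.1 - w.2) = h / 2 + (1 / 2) * (∫ s in (0 : ℝ)..w.1, q s) +
        ∫ a in (0 : ℝ)..w.1, ∫ b in (0 : ℝ)..w.2, q (a + b) * K (a + b, a - b) := by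
    intro K hK w hw
    have := hK.2 _ (mem w hw)
    simpa [add_self_div_two] using this
  have key := volterra_unique (Q := fun w => q (w.1 + w.2))
    (k₁ := fun w => K₁ (w.1 + w.2, w.1 - w.2)) (k₂ := fun w => K₂ (w.1 + w.2, w.1 - w.2))
    (g := fun w => h / 2 + (1 / 2) * (∫ s in (0 : ℝ)..w.1, q s))
    (hq.comp (by fun_prop) fun w hw => (mem w hw).1) (cK h₁.1) (cK h₂.1) (e h₁) (e h₂)
    (x := charCoord z) ⟨right_mem_uIcc, right_mem_uIcc⟩
  have e1 : (charCoord z).1 + (charCoord z).2 = z.1 := by simp [charCoord]; ring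
  have e2 : (charCoord z).1 - (charCoord z).2 = z.2 := by simp [charCoord]; ring
  simpa only [e1, e2, Prod.mk.eta] using key

/-- The kernel at `(ξ, τ)` depends only on the potential between `0` and `ξ`, so that kernels on
compact subintervals determine a kernel. -/
theorem exists_of_compact (hJ : J.OrdConnected) (h0 : (0 : ℝ) ∈ J) (hq : ContinuousOn q J)
    (hloc : ∀ α β, Icc α β ⊆ J → (0 : ℝ) ∈ Icc α β →
      ∃ K, IsGoursatKernel (Icc α β) q h K) :
    ∃ K, IsGoursatKernel J q h K := by
  have hloc' : ∀ ξ, ∃ K, ξ ∈ J → IsGoursatKernel (uIcc 0 ξ) q h K := fun ξ => by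
    by_cases hξ : ξ ∈ J
    · obtain ⟨K, hK⟩ := hloc _ _ (uIcc_zero_subset hJ h0 hξ) (left_mem_uIcc (b := ξ))
      exact ⟨K, fun _ => hK⟩
    · exact ⟨0, fun h => (hξ h).elim⟩
  choose k hk using hloc'
  have heq : ∀ {J' : Set ℝ} {K : ℝ × ℝ → ℝ}, J' ⊆ J → J'.OrdConnected → (0 : ℝ) ∈ J' →
      IsGoursatKernel J' q h K → EqOn (fun z => k z.1 z) K (kernelDomain J') := by
    intro J' K hs ho h0' hK z hz
    have hsub := uIcc_zero_subset ho h0' hz.1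
    exact (hk z.1 (hs hz.1)).unique ordConnected_uIcc left_mem_uIcc
      (hq.mono (hsub.trans hs)) (hK.mono hsub) ⟨right_mem_uIcc, hz.2⟩
  -- The glued kernel takes at z the kernel chosen for the interval between 0 and z.1. By `heq` it
  -- coincides with every kernel on a subinterval containing 0, which gives continuity and the
  -- integral equation.
  refine ⟨fun z => k z.1 z, fun z hz => ?_, fun z hz => ?_⟩
  · obtain ⟨α, β, hsub, hz1, h0', hnhds⟩ := exists_compact_interval_nhdsWithin hJ hz.1 h0
    obtain ⟨K, hK⟩ := hloc α β hsub h0'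
    have he := heq hsub ordConnected_Icc h0' hK
    have hcont : ContinuousWithinAt K (kernelDomain (Icc α β)) z := hK.1 z ⟨hz1, hz.2⟩
    refine (hcont.congr he (he ⟨hz1, hz.2⟩)).mono_of_mem_nhdsWithin ?_
    have : Tendsto Prod.fst (𝓝[kernelDomain J] z) (𝓝[J] z.1) :=
      continuousWithinAt_fst.tendsto_nhdsWithin fun w hw => hw.1
    filter_upwards [this hnhds, self_mem_nhdsWithin] with w hw hw' using ⟨hw, hw'.2⟩
  · have hsub := uIcc_zero_subset hJ h0 hz.1
    have := (hk z.1 hz.1).2 z ⟨right_mem_uIcc, hz.2⟩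
    refine this.trans ?_
    congr 1
    refine intervalIntegral.integral_congr fun a ha => intervalIntegral.integral_congr
      fun b hb => ?_
    have hm := charRectangle_mem hz.2 ha hb
    have := heq hsub ordConnected_uIcc left_mem_uIcc (hk z.1 hz.1) hm
    simp only at this ⊢
    rw [this]

theorem congr (hK : IsGoursatKernel J q h K) (hJ : J.OrdConnected) (h0 : (0 : ℝ) ∈ J)
    (hq : EqOn q' q J) : IsGoursatKernel J q' h K := by
  refine ⟨hK.1, fun z hz => ?_⟩
  have hsub := uIcc_zero_subset hJ h0 hz.1
  rw [hK.2 z hz]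
  congr 1
  · congr 2
    exact intervalIntegral.integral_congr fun s hs => (hq (hsub (half_add_mem_uIcc hz.2 hs))).symm
  · refine intervalIntegral.integral_congr fun a ha => intervalIntegral.integral_congr
      fun b hb => ?_
    rw [hq (hsub (charRectangle_mem hz.2 ha hb).1)]

end IsGoursatKernel

theorem IsDarbouxPair.isGoursatKernel {p : ℝ → ℝ} {K L : ℝ × ℝ → ℝ} (h : IsDarbouxPair p K L)
    (J : Set ℝ) : IsGoursatKernel J (fun s => deriv p s + p s ^ 2) (p 0) K :=
  ⟨h.contDiff_fst.continuous.continuousOn, fun z _ => h.goursat z⟩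

end GoursatKernel

/-! ### The potential f''/f and the transmutation kernels of f and 1/f -/

section Admissible

/-- The assumptions on the coefficient of the Vekua equation. -/
structure IsAdmissible (J : Set ℝ) (f : ℝ → ℝ) : Prop where
  ordConnected : J.OrdConnected
  nontrivial : J.Nontrivial
  zero_mem : (0 : ℝ) ∈ J
  contDiffOn : ContDiffOn ℝ 2 f J
  ne_zero : ∀ ξ ∈ J, f ξ ≠ 0
  map_zero : f 0 = 1

/-- The logarithmic derivative within a set. -/
def logDerivWithin (J : Set ℝ) (f : ℝ → ℝ) (ξ : ℝ) : ℝ := derivWithin f J ξ / f ξ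

namespace IsAdmissible

variable {J : Set ℝ} {f : ℝ → ℝ}

theorem inv (h : IsAdmissible J f) : IsAdmissible J (fun ξ => (f ξ)⁻¹) where
  ordConnected := h.ordConnected
  nontrivial := h.nontrivial
  zero_mem := h.zero_mem
  contDiffOn := h.contDiffOn.inv h.ne_zero
  ne_zero ξ hξ := inv_ne_zero (h.ne_zero ξ hξ)
  map_zero := by simp [h.map_zero]

theorem uniqueDiffOn (h : IsAdmissible J f) : UniqueDiffOn ℝ J :=
  interval_uniqueDiffOn h.ordConnected h.nontrivial

theorem contDiffOn_derivWithin (h : IsAdmissible J f) : ContDiffOn ℝ 1 (derivWithin f J) J :=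
  h.contDiffOn.derivWithin h.uniqueDiffOn (by norm_num)

theorem contDiffOn_logDerivWithin (h : IsAdmissible J f) : ContDiffOn ℝ 1 (logDerivWithin J f) J :=
  h.contDiffOn_derivWithin.div (h.contDiffOn.of_le (by norm_num)) h.ne_zero

theorem hasDerivWithinAt (h : IsAdmissible J f) {ξ : ℝ} (hξ : ξ ∈ J) :
    HasDerivWithinAt f (derivWithin f J ξ) J ξ :=
  (h.contDiffOn.differentiableOn two_ne_zero ξ hξ).hasDerivWithinAt

theorem logDerivWithin_inv (h : IsAdmissible J f) {ξ : ℝ} (hξ : ξ ∈ J) :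
    logDerivWithin J (fun ξ => (f ξ)⁻¹) ξ = -logDerivWithin J f ξ := by
  have hf := h.ne_zero ξ hξ
  unfold logDerivWithin
  rw [((h.hasDerivWithinAt hξ).fun_inv hf).derivWithin (h.uniqueDiffOn ξ hξ)]
  field_simp

/-- The Riccati identity p' + p² = f''/f for p = f'/f links the first order system to the potential
of the Goursat problem. -/
theorem derivWithin_logDerivWithin (h : IsAdmissible J f) {ξ : ℝ} (hξ : ξ ∈ J) :
    derivWithin (logDerivWithin J f) J ξ + logDerivWithin J f ξ ^ 2 = darbouxPotential J f ξ := by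
  have hf := h.ne_zero ξ hξ
  have h1 := (h.contDiffOn_derivWithin.differentiableOn one_ne_zero ξ hξ).hasDerivWithinAt
  have h2 : HasDerivWithinAt (logDerivWithin J f) _ J ξ := h1.fun_div (h.hasDerivWithinAt hξ) hf
  rw [h2.derivWithin (h.uniqueDiffOn ξ hξ)]
  unfold logDerivWithin darbouxPotential
  field_simp
  ring

theorem logDerivWithin_zero (h : IsAdmissible J f) : logDerivWithin J f 0 = derivWithin f J 0 := by
  simp [logDerivWithin, h.map_zero]

theorem continuousOn_darbouxPotential (h : IsAdmissible J f) :
    ContinuousOn (darbouxPotential J f) J :=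
  (h.contDiffOn_derivWithin.continuousOn_derivWithin h.uniqueDiffOn le_rfl).div
    h.contDiffOn.continuousOn h.ne_zero

/-- On a compact subinterval the kernels extend to a pair of `C¹` kernels on the plane. -/
theorem exists_local_pair (h : IsAdmissible J f) {α β : ℝ} (hsub : Icc α β ⊆ J)
    (h0 : (0 : ℝ) ∈ Icc α β) :
    ∃ (p : ℝ → ℝ) (K L : ℝ × ℝ → ℝ), EqOn p (logDerivWithin J f) (Icc α β) ∧
      IsDarbouxPair p K L ∧ IsDarbouxPair (fun x => -p x) L K ∧
      IsGoursatKernel (Icc α β) (darbouxPotential J f) (derivWithin f J 0) K ∧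
      IsGoursatKernel (Icc α β) (darbouxPotential J fun ξ => (f ξ)⁻¹)
        (derivWithin (fun ξ => (f ξ)⁻¹) J 0) L := by
  obtain ⟨p, hp, ⟨B, hB⟩, hpe⟩ := exists_contDiff_extension h.ordConnected h.nontrivial
    h.contDiffOn_logDerivWithin (h0.1.trans h0.2) hsub
  obtain ⟨K, L, hK, hL⟩ := exists_isDarbouxPair hp hB
  refine ⟨p, K, L, fun x hx => (hpe x hx).1, hK, hL, ?_, ?_⟩
  · have := hK.isGoursatKernel (Icc α β)
    rw [(hpe 0 h0).1, h.logDerivWithin_zero] at this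
    refine this.congr ordConnected_Icc h0 fun x hx => ?_
    simp only [← h.derivWithin_logDerivWithin (hsub hx), (hpe x hx).1, (hpe x hx).2]
  · have := hL.isGoursatKernel (Icc α β)
    rw [(hpe 0 h0).1, ← h.logDerivWithin_inv h.zero_mem, h.inv.logDerivWithin_zero] at this
    refine this.congr ordConnected_Icc h0 fun x hx => ?_
    -- The potential of 1/f is -p' + p², since its logarithmic derivative is -p.
    rw [← h.inv.derivWithin_logDerivWithin (hsub hx), h.logDerivWithin_inv (hsub hx),
      derivWithin_congr (fun y hy => h.logDerivWithin_inv hy) (h.logDerivWithin_inv (hsub hx)),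
      derivWithin.fun_neg]
    simp only [deriv.fun_neg, (hpe x hx).1, (hpe x hx).2]

theorem isTransmutationKernel (h : IsAdmissible J f) :
    IsTransmutationKernel J f (transmutationKernel J f) := by
  refine Classical.epsilon_spec (p := IsTransmutationKernel J f) ?_
  refine IsGoursatKernel.exists_of_compact h.ordConnected h.zero_mem
    h.continuousOn_darbouxPotential fun α β hsub h0 => ?_
  obtain ⟨p, K, L, -, -, -, hK, -⟩ := h.exists_local_pair hsub h0
  exact ⟨K, hK⟩

theorem transmutationKernel_unique (h : IsAdmissible J f) {K : ℝ × ℝ → ℝ}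
    (hK : IsTransmutationKernel J f K) : EqOn K (transmutationKernel J f) (kernelDomain J) :=
  IsGoursatKernel.unique h.ordConnected h.zero_mem h.continuousOn_darbouxPotential hK
    h.isTransmutationKernel

theorem transmutationKernel_eqOn (h : IsAdmissible J f) {J' : Set ℝ} (hJ' : J'.OrdConnected)
    (hsub : J' ⊆ J) (h0 : (0 : ℝ) ∈ J') {K : ℝ × ℝ → ℝ}
    (hK : IsGoursatKernel J' (darbouxPotential J f) (derivWithin f J 0) K) :
    EqOn (transmutationKernel J f) K (kernelDomain J') :=
  IsGoursatKernel.unique hJ' h0 (h.continuousOn_darbouxPotential.mono hsub)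
    (h.isTransmutationKernel.mono hsub) hK

/-- Near each point, uniqueness identifies the kernel with the restriction of a C¹ function on the
plane, so points on the boundary need no separate treatment. -/
theorem contDiffOn_transmutationKernel (h : IsAdmissible J f) :
    ContDiffOn ℝ 1 (transmutationKernel J f) (kernelDomain J) := by
  intro z hz
  obtain ⟨α, β, hsub, hz1, h0, hnhds⟩ :=
    exists_compact_interval_nhdsWithin h.ordConnected hz.1 h.zero_mem
  obtain ⟨p, K, L, -, hKL, -, hK, -⟩ := h.exists_local_pair hsub h0
  have he := h.transmutationKernel_eqOn ordConnected_Icc hsub h0 hK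
  refine (hKL.contDiff_fst.contDiffAt.contDiffWithinAt).congr_of_eventuallyEq ?_
    (he ⟨hz1, hz.2⟩)
  have : Tendsto Prod.fst (𝓝[kernelDomain J] z) (𝓝[J] z.1) :=
    continuousWithinAt_fst.tendsto_nhdsWithin fun w hw => hw.1
  filter_upwards [this hnhds, self_mem_nhdsWithin] with w hw hw' using he ⟨hw, hw'.2⟩

end IsAdmissible

end Admissible

/-! ### Volterra operators and the intertwining relation -/

section Transform

/-- The Volterra operator with kernel `K`, applied in the first variable. -/
def volterraTransform (K : ℝ × ℝ → ℝ) (φ : ℝ × ℝ → ℂ) (z : ℝ × ℝ) : ℂ :=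
  φ z + ∫ τ in (-z.1)..z.1, (K (z.1, τ) : ℂ) * φ (τ, z.2)

theorem hasDerivAt_slice_fst {E : Type*} [NormedAddCommGroup E] [NormedSpace ℝ E]
    {F : ℝ × ℝ → E} (hF : ContDiff ℝ 1 F) (x y : ℝ) :
    HasDerivAt (fun s => F (s, y)) (fderiv ℝ F (x, y) (1, 0)) x :=
  ((hF.differentiable one_ne_zero (x, y)).hasFDerivAt).comp_hasDerivAt x (f := fun s => (s, y))
    ((hasDerivAt_id x).prodMk (hasDerivAt_const _ _))

theorem hasDerivAt_slice_snd {E : Type*} [NormedAddCommGroup E] [NormedSpace ℝ E]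
    {F : ℝ × ℝ → E} (hF : ContDiff ℝ 1 F) (x y : ℝ) :
    HasDerivAt (fun s => F (x, s)) (fderiv ℝ F (x, y) (0, 1)) y :=
  ((hF.differentiable one_ne_zero (x, y)).hasFDerivAt).comp_hasDerivAt y (f := fun s => (x, s))
    ((hasDerivAt_const _ _).prodMk (hasDerivAt_id y))

theorem ContDiff.continuous_partial {E : Type*} [NormedAddCommGroup E] [NormedSpace ℝ E]
    {F : ℝ × ℝ → E} (hF : ContDiff ℝ 1 F) (v : ℝ × ℝ) : Continuous fun z => fderiv ℝ F z v :=
  (hF.continuous_fderiv one_ne_zero).clm_apply continuous_const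

theorem continuous_integral_symm {G : (ℝ × ℝ) × ℝ → ℂ} (hG : Continuous G) :
    Continuous fun z : ℝ × ℝ => ∫ τ in (-z.1)..z.1, G (z, τ) := by
  have h : ∀ z : ℝ × ℝ, ∫ τ in (-z.1)..z.1, G (z, τ) =
      (∫ τ in (0 : ℝ)..z.1, G (z, τ)) - ∫ τ in (0 : ℝ)..(-z.1), G (z, τ) := fun z =>
    (intervalIntegral.integral_interval_sub_left
      (Continuous.intervalIntegrable (by fun_prop) _ _)
      (Continuous.intervalIntegrable (by fun_prop) _ _)).symm
  simp_rw [h]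
  exact (intervalIntegral.continuous_parametric_intervalIntegral_of_continuous
    (f := fun z τ => G (z, τ)) hG continuous_fst).sub
    (intervalIntegral.continuous_parametric_intervalIntegral_of_continuous
    (f := fun z τ => G (z, τ)) hG continuous_fst.neg)

variable {K : ℝ × ℝ → ℝ} {φ : ℝ × ℝ → ℂ}

theorem hasDerivAt_volterraTransform_fst (hK : ContDiff ℝ 1 K) (hφ : ContDiff ℝ 1 φ)
    (z : ℝ × ℝ) :
    HasDerivAt (fun x => volterraTransform K φ (x, z.2))
      (fderiv ℝ φ z (1, 0) + ((∫ τ in (-z.1)..z.1,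
        (fderiv ℝ K (z.1, τ) (1, 0) : ℂ) * φ (τ, z.2)) +
        K (z.1, z.1) * φ (z.1, z.2) + K (z.1, -z.1) * φ (-z.1, z.2))) z.1 := by
  obtain ⟨ξ, t⟩ := z
  have cK := hK.continuous
  have cφ := hφ.continuous
  have cK' := hK.continuous_partial (1, 0)
  have i : ∀ x a b, IntervalIntegrable (fun τ => (K (x, τ) : ℂ) * φ (τ, t)) volume a b :=
    fun x a b => Continuous.intervalIntegrable (by fun_prop) _ _
  have i' : ∀ x a b, IntervalIntegrable
      (fun τ => (fderiv ℝ K (x, τ) (1, 0) : ℂ) * φ (τ, t)) volume a b :=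
    fun x a b => Continuous.intervalIntegrable (by fun_prop) _ _
  -- The upper limit is decoupled from the parameter. Composing with x ↦ (x, x) and x ↦ (x, -x) then
  -- yields the Leibniz rule with moving endpoints.
  have hH := hasFDerivAt_of_continuous_partials
    (F := fun w : ℝ × ℝ => ∫ τ in (0 : ℝ)..w.2, (K (w.1, τ) : ℂ) * φ (τ, t))
    (F₁ := fun w => ∫ τ in (0 : ℝ)..w.2, (fderiv ℝ K (w.1, τ) (1, 0) : ℂ) * φ (τ, t))
    (F₂ := fun w => (K w : ℂ) * φ (w.2, t))
    (fun w => hasDerivAt_integral_of_continuous (k := fun x τ => (K (x, τ) : ℂ) * φ (τ, t))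
      (k' := fun x τ => (fderiv ℝ K (x, τ) (1, 0) : ℂ) * φ (τ, t))
      (by unfold Function.uncurry; fun_prop) (by unfold Function.uncurry; fun_prop)
      (fun x τ => ((hasDerivAt_slice_fst hK x τ).ofReal_comp).mul_const _) 0 w.2 w.1)
    (fun w => intervalIntegral.integral_hasDerivAt_right (i _ _ _)
      ((by fun_prop : Continuous fun τ => (K (w.1, τ) : ℂ) * φ (τ, t)).stronglyMeasurableAtFilter
        _ _) (by fun_prop))
    (intervalIntegral.continuous_parametric_intervalIntegral_of_continuous
      (f := fun (w : ℝ × ℝ) τ => (fderiv ℝ K (w.1, τ) (1, 0) : ℂ) * φ (τ, t))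
      (by unfold Function.uncurry; fun_prop) continuous_snd) (by fun_prop)
  have h1 := (hH (ξ, ξ)).comp_hasDerivAt ξ (f := fun x => (x, x))
    ((hasDerivAt_id ξ).prodMk (hasDerivAt_id ξ))
  have h2 := (hH (ξ, -ξ)).comp_hasDerivAt ξ (f := fun x => (x, -x))
    ((hasDerivAt_id ξ).prodMk (hasDerivAt_neg ξ))
  have h3 := (hasDerivAt_slice_fst hφ ξ t).add (h1.sub h2)
  refine (h3.congr_of_eventuallyEq (Eventually.of_forall fun x => ?_)).congr_deriv ?_
  · simp only [volterraTransform, Pi.add_apply, Pi.sub_apply, Function.comp_apply]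
    rw [intervalIntegral.integral_interval_sub_left (i _ _ _) (i _ _ _)]
  · rw [← intervalIntegral.integral_interval_sub_left (i' ξ 0 ξ) (i' ξ 0 (-ξ))]
    simp
    ring

theorem hasDerivAt_volterraTransform_snd (hK : ContDiff ℝ 1 K) (hφ : ContDiff ℝ 1 φ)
    (z : ℝ × ℝ) :
    HasDerivAt (fun t => volterraTransform K φ (z.1, t))
      (fderiv ℝ φ z (0, 1) + ∫ τ in (-z.1)..z.1,
        (K (z.1, τ) : ℂ) * fderiv ℝ φ (τ, z.2) (0, 1)) z.2 := by
  have cK := hK.continuous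
  have cφ := hφ.continuous
  have cφ' := hφ.continuous_partial (0, 1)
  exact (hasDerivAt_slice_snd hφ z.1 z.2).add
    (hasDerivAt_integral_of_continuous (k := fun t τ => (K (z.1, τ) : ℂ) * φ (τ, t))
      (k' := fun t τ => (K (z.1, τ) : ℂ) * fderiv ℝ φ (τ, t) (0, 1))
      (by unfold Function.uncurry; fun_prop) (by unfold Function.uncurry; fun_prop)
      (fun t τ => (hasDerivAt_slice_snd hφ τ t).const_mul _) (-z.1) z.1 z.2)

theorem contDiff_volterraTransform (hK : ContDiff ℝ 1 K) (hφ : ContDiff ℝ 1 φ) :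
    ContDiff ℝ 1 (volterraTransform K φ) := by
  have cK := hK.continuous
  have cφ := hφ.continuous
  have cK' := hK.continuous_partial (1, 0)
  have cφ₁ := hφ.continuous_partial (1, 0)
  have cφ₂ := hφ.continuous_partial (0, 1)
  refine contDiff_of_continuous_partials (hasDerivAt_volterraTransform_fst hK hφ)
    (hasDerivAt_volterraTransform_snd hK hφ) ?_ ?_
  · have := continuous_integral_symm
      (G := fun w => (fderiv ℝ K (w.1.1, w.2) (1, 0) : ℂ) * φ (w.2, w.1.2)) (by fun_prop)
    fun_prop
  · have := continuous_integral_symm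
      (G := fun w => (K (w.1.1, w.2) : ℂ) * fderiv ℝ φ (w.2, w.1.2) (0, 1)) (by fun_prop)
    fun_prop

/-- The intertwining relation `(∂_ξ - p) T_K = T_L ∂_ξ`. -/
theorem IsDarbouxPair.volterraTransform_intertwine {p : ℝ → ℝ} {L : ℝ × ℝ → ℝ}
    {ψ : ℝ × ℝ → ℂ} (h : IsDarbouxPair p K L) (hφ : ContDiff ℝ 1 φ) (hψ : ContDiff ℝ 1 ψ)
    (hφψ : ∀ z, fderiv ℝ φ z (1, 0) = fderiv ℝ ψ z (0, 1)) (z : ℝ × ℝ) :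
    fderiv ℝ (volterraTransform K φ) z (1, 0) - fderiv ℝ (volterraTransform L ψ) z (0, 1) =
      p z.1 * volterraTransform K φ z := by
  have hK := h.contDiff_fst
  have hL := h.contDiff_snd
  have cK := hK.continuous
  have cL := hL.continuous
  have cφ := hφ.continuous
  have cK' := hK.continuous_partial (1, 0)
  have cL' := hL.continuous_partial (0, 1)
  have cφ' := hφ.continuous_partial (1, 0)
  rw [(hasDerivAt_slice_fst (contDiff_volterraTransform hK hφ) z.1 z.2).unique
      (hasDerivAt_volterraTransform_fst hK hφ z),
    (hasDerivAt_slice_snd (contDiff_volterraTransform hL hψ) z.1 z.2).unique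
      (hasDerivAt_volterraTransform_snd hL hψ z)]
  simp only [← hφψ]
  -- Integration by parts moves the derivative from φ to L. The interior terms combine to K_ξ + L_τ
  -- = p K; the boundary terms become (K - L)(ξ, ξ) = p(ξ) and (K + L)(ξ, -ξ) = 0.
  have ftc := intervalIntegral.integral_eq_sub_of_hasDerivAt (a := -z.1) (b := z.1)
    (f := fun τ => (L (z.1, τ) : ℂ) * φ (τ, z.2))
    (f' := fun τ => (fderiv ℝ L (z.1, τ) (0, 1) : ℂ) * φ (τ, z.2) +
      (L (z.1, τ) : ℂ) * fderiv ℝ φ (τ, z.2) (1, 0))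
    (fun τ _ => ((hasDerivAt_slice_snd hL z.1 τ).ofReal_comp).mul
      (hasDerivAt_slice_fst hφ τ z.2))
    (Continuous.intervalIntegrable (by fun_prop) _ _)
  rw [intervalIntegral.integral_add (Continuous.intervalIntegrable (by fun_prop) _ _)
    (Continuous.intervalIntegrable (by fun_prop) _ _)] at ftc
  have hint : (∫ τ in (-z.1)..z.1, (fderiv ℝ K (z.1, τ) (1, 0) : ℂ) * φ (τ, z.2)) +
      (∫ τ in (-z.1)..z.1, (fderiv ℝ L (z.1, τ) (0, 1) : ℂ) * φ (τ, z.2)) =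
      p z.1 * ∫ τ in (-z.1)..z.1, (K (z.1, τ) : ℂ) * φ (τ, z.2) := by
    rw [← intervalIntegral.integral_const_mul,
      ← intervalIntegral.integral_add (Continuous.intervalIntegrable (by fun_prop) _ _)
        (Continuous.intervalIntegrable (by fun_prop) _ _)]
    congr 1
    ext τ
    rw [← add_mul, ← Complex.ofReal_add, h.intertwine (z.1, τ), Complex.ofReal_mul, mul_assoc]
  have hd : (K (z.1, z.1) : ℂ) - L (z.1, z.1) = p z.1 := by
    rw [← Complex.ofReal_sub, h.diagonal]
  have ha : (K (z.1, -z.1) : ℂ) + L (z.1, -z.1) = 0 := by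
    rw [← Complex.ofReal_add, h.antidiagonal, Complex.ofReal_zero]
  unfold volterraTransform
  rw [mul_add, ← hint, ← hd]
  linear_combination (-1 : ℂ) * ftc + φ (-z.1, z.2) * ha

end Transform

/-! ### The formula solves the Cauchy problem -/

section VekuaFormula

variable {J S : Set ℝ} {f : ℝ → ℝ} {W₀ : ℝ → Bicomplex} {W : ℝ × ℝ → Bicomplex}

theorem cauchyDomain_convex (hJ : J.OrdConnected) (hS : S.OrdConnected) :
    Convex ℝ (cauchyDomain J S) := by
  have h1 := hJ.convex.is_linear_preimage (𝕜 := ℝ) (f := fun p : ℝ × ℝ => p.1)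
    ⟨fun _ _ => rfl, fun _ _ => rfl⟩
  have h2 := hS.convex.is_linear_preimage (𝕜 := ℝ) (f := fun p : ℝ × ℝ => p.2 - p.1)
    ⟨fun _ _ => by simp; ring, fun _ _ => by simp; ring⟩
  have h3 := hS.convex.is_linear_preimage (𝕜 := ℝ) (f := fun p : ℝ × ℝ => p.2 + p.1)
    ⟨fun _ _ => by simp; ring, fun _ _ => by simp; ring⟩
  exact h1.inter (h2.inter h3)

/-- Derivatives within the domain are then well determined at its boundary points. A convex set only
needs an interior point for this. -/
theorem cauchyDomain_uniqueDiffOn (hJ : J.OrdConnected) (hJn : J.Nontrivial) (h0 : (0 : ℝ) ∈ J)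
    (hS : S.OrdConnected) (hSn : S.Nontrivial) : UniqueDiffOn ℝ (cauchyDomain J S) := by
  refine uniqueDiffOn_convex (cauchyDomain_convex hJ hS) ?_
  obtain ⟨s, hs⟩ := interior_nonempty_of_nontrivial hS hSn
  have hopen : IsOpen {x : ℝ | s - x ∈ interior S ∧ s + x ∈ interior S} :=
    (isOpen_interior.preimage (by fun_prop : Continuous fun x : ℝ => s - x)).inter
      (isOpen_interior.preimage (by fun_prop : Continuous fun x : ℝ => s + x))
  -- 0 may be an endpoint of `J`, so the interior point is taken at a small ξ in the interior of
  -- `J`, over an interior point s of `S`.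
  have hcl : (0 : ℝ) ∈ closure (interior J) := by
    rw [(hJ.convex (𝕜 := ℝ)).closure_interior_eq_closure_of_nonempty_interior
      (interior_nonempty_of_nontrivial hJ hJn)]
    exact subset_closure h0
  obtain ⟨x, hx, hxJ⟩ := mem_closure_iff.1 hcl _ hopen (by simpa using hs)
  refine ⟨(x, s), mem_interior.2 ⟨_, fun p hp => ⟨?_, ?_, ?_⟩,
    (isOpen_interior.preimage continuous_fst).inter
      ((isOpen_interior.preimage (by fun_prop : Continuous fun p : ℝ × ℝ => p.2 - p.1)).inter
      (isOpen_interior.preimage (by fun_prop : Continuous fun p : ℝ × ℝ => p.2 + p.1))),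
    hxJ, hx.1, hx.2⟩⟩
  · exact interior_subset hp.1
  · exact interior_subset hp.2.1
  · exact interior_subset hp.2.2

theorem zero_mem_cauchyDomain (h0 : (0 : ℝ) ∈ J) {t : ℝ} (ht : t ∈ S) :
    ((0, t) : ℝ × ℝ) ∈ cauchyDomain J S := ⟨h0, by simpa using ht, by simpa using ht⟩

/-- The hyperbolic Vekua equation in terms of the components of `W`. -/
theorem vekua_equation_iff {D : Set (ℝ × ℝ)} {p : ℝ × ℝ} :
    dbar W D p - ofC ((derivWithin f J p.1 / (2 * f p.1) : ℝ) : ℂ) * star (W p) = 0 ↔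
      fderivWithin ℝ (fun q => (W q).re) D p (1, 0) - fderivWithin ℝ (fun q => (W q).im) D p (0, 1)
          = logDerivWithin J f p.1 * (W p).re ∧
      fderivWithin ℝ (fun q => (W q).im) D p (1, 0) - fderivWithin ℝ (fun q => (W q).re) D p (0, 1)
          = -logDerivWithin J f p.1 * (W p).im := by
  have e : (derivWithin f J p.1 / (2 * f p.1)) = logDerivWithin J f p.1 / 2 := by
    rw [logDerivWithin, div_div, mul_comm]
  rw [e, QuadraticAlgebra.ext_iff]
  simp only [dbar, dirDeriv, ofC, j, QuadraticAlgebra.re_sub, QuadraticAlgebra.im_sub,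
    QuadraticAlgebra.re_mul, QuadraticAlgebra.im_mul, QuadraticAlgebra.re_star,
    QuadraticAlgebra.im_star, QuadraticAlgebra.re_zero, QuadraticAlgebra.im_zero]
  push_cast
  constructor
  · rintro ⟨h1, h2⟩
    constructor
    · linear_combination 2 * h1
    · linear_combination 2 * h2
  · rintro ⟨h1, h2⟩
    constructor
    · linear_combination h1 / 2
    · linear_combination h2 / 2

theorem vekuaFormula_re (p : ℝ × ℝ) : (vekuaFormula J f W₀ p).re = 1 / 2 *
    transmutation J f (fun τ => plus (W₀ (p.2 + τ)) + minus (W₀ (p.2 - τ))) p.1 := by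
  simp [vekuaFormula, ofC, j]

theorem vekuaFormula_im (p : ℝ × ℝ) : (vekuaFormula J f W₀ p).im = 1 / 2 *
    transmutation J (fun ξ => (f ξ)⁻¹)
      (fun τ => plus (W₀ (p.2 + τ)) - minus (W₀ (p.2 - τ))) p.1 := by
  simp [vekuaFormula, ofC, j]

/-- For |τ| ≤ |ξ| the points t ± τ lie between t - ξ and t + ξ. Hence only the data on `S'` and the
kernel over `J'` matter, and both may be replaced by extensions. -/
theorem transmutation_eq_volterraTransform {J' S' : Set ℝ} {g : ℝ → ℝ} {K : ℝ × ℝ → ℝ}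
    (hK : EqOn (transmutationKernel J g) K (kernelDomain J')) {u : ℝ → ℂ} {φ : ℝ × ℝ → ℂ}
    {z : ℝ × ℝ} (hz : z.1 ∈ J') (hS' : S'.OrdConnected) (hz1 : z.2 - z.1 ∈ S')
    (hz2 : z.2 + z.1 ∈ S') (hu : ∀ τ, z.2 - τ ∈ S' → z.2 + τ ∈ S' → u τ = φ (τ, z.2)) :
    transmutation J g u z.1 = volterraTransform K φ z := by
  unfold transmutation volterraTransform
  rw [hu z.1 hz1 hz2]
  congr 1
  refine intervalIntegral.integral_congr fun τ hτ => ?_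
  have habs : |τ| ≤ |z.1| := by
    rw [abs_le]
    rcases le_total 0 z.1 with h | h
    · rw [uIcc_of_le (by linarith)] at hτ
      rw [abs_of_nonneg h]
      exact hτ
    · rw [uIcc_of_ge (by linarith)] at hτ
      rw [abs_of_nonpos h, neg_neg]
      exact hτ
  have hmem : ∀ σ, |σ| ≤ |z.1| → z.2 + σ ∈ S' := by
    intro σ hσ
    rw [abs_le] at hσ
    rcases le_total 0 z.1 with h | h
    · rw [abs_of_nonneg h] at hσ
      exact hS'.out hz1 hz2 ⟨by linarith [hσ.1], by linarith [hσ.2]⟩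
    · rw [abs_of_nonpos h] at hσ
      exact hS'.out hz2 hz1 ⟨by linarith [hσ.1], by linarith [hσ.2]⟩
  have h1 := hmem (-τ) (by rwa [abs_neg])
  rw [← sub_eq_add_neg] at h1
  rw [hu τ h1 (hmem τ habs), hK (show (z.1, τ) ∈ kernelDomain J' from ⟨hz, habs⟩)]

/-- Near each point of its domain the function given by the formula is the restriction of a `C¹`
solution on the plane. -/
theorem exists_local_solution (hf : IsAdmissible J f) (hS : S.OrdConnected) (hSn : S.Nontrivial)
    (hW₀ : C1On W₀ S) {z₀ : ℝ × ℝ} (hz₀ : z₀ ∈ cauchyDomain J S) :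
    ∃ (r : ℝ → ℝ) (u v : ℝ × ℝ → ℂ), ContDiff ℝ 1 u ∧ ContDiff ℝ 1 v ∧
      r z₀.1 = logDerivWithin J f z₀.1 ∧
      (∀ z, fderiv ℝ u z (1, 0) - fderiv ℝ v z (0, 1) = r z.1 * u z) ∧
      (∀ z, fderiv ℝ v z (1, 0) - fderiv ℝ u z (0, 1) = -r z.1 * v z) ∧
      ∀ᶠ z in 𝓝[cauchyDomain J S] z₀,
        (vekuaFormula J f W₀ z).re = u z ∧ (vekuaFormula J f W₀ z).im = v z := by
  obtain ⟨α, β, hsub, hξ₀, h0, hJn⟩ :=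
    exists_compact_interval_nhdsWithin hf.ordConnected hz₀.1 hf.zero_mem
  obtain ⟨r, K, L, hr, hKL, hLK, hK, hL⟩ := hf.exists_local_pair hsub h0
  have eK := hf.transmutationKernel_eqOn ordConnected_Icc hsub h0 hK
  have eL := hf.inv.transmutationKernel_eqOn ordConnected_Icc hsub h0 hL
  obtain ⟨a₁, b₁, hs₁, hx₁, hy₁, hn₁⟩ := exists_compact_interval_nhdsWithin hS hz₀.2.1 hz₀.2.2
  obtain ⟨a₂, b₂, hs₂, hx₂, hy₂, hn₂⟩ := exists_compact_interval_nhdsWithin hS hz₀.2.2 hz₀.2.1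
  have hab₁ : a₁ ≤ b₁ := hx₁.1.trans hx₁.2
  have hab₂ : a₂ ≤ b₂ := hx₂.1.trans hx₂.2
  -- A single compact interval must contain both t - ξ and t + ξ for all nearby points of the
  -- domain.
  have hsS : Icc (min a₁ a₂) (max b₁ b₂) ⊆ S := by
    refine hS.out ?_ ?_
    · rcases min_choice a₁ a₂ with h | h <;> rw [h]
      exacts [hs₁ (left_mem_Icc.2 hab₁), hs₂ (left_mem_Icc.2 hab₂)]
    · rcases max_choice b₁ b₂ with h | h <;> rw [h]
      exacts [hs₁ (right_mem_Icc.2 hab₁), hs₂ (right_mem_Icc.2 hab₂)]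
  have hle : min a₁ a₂ ≤ max b₁ b₂ := (min_le_left _ _).trans (hab₁.trans (le_max_left _ _))
  obtain ⟨A, hA, -, eA⟩ := exists_contDiff_extension hS hSn
    (F := fun t => plus (W₀ t)) (hW₀.1.add hW₀.2) hle hsS
  obtain ⟨B, hB, -, eB⟩ := exists_contDiff_extension hS hSn
    (F := fun t => minus (W₀ t)) (hW₀.1.sub hW₀.2) hle hsS
  -- The d'Alembert pair of the case f = 1: φ_ξ = ψ_t and ψ_ξ = φ_t, which is what the intertwining
  -- relations for p and -p consume.
  set φ : ℝ × ℝ → ℂ := fun z => A (z.2 + z.1) + B (z.2 - z.1) with hφ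
  set ψ : ℝ × ℝ → ℂ := fun z => A (z.2 + z.1) - B (z.2 - z.1) with hψ
  have cφ : ContDiff ℝ 1 φ := by fun_prop
  have cψ : ContDiff ℝ 1 ψ := by fun_prop
  have dA : ∀ x, HasDerivAt A (deriv A x) x := fun x =>
    (hA.differentiable one_ne_zero x).hasDerivAt
  have dB : ∀ x, HasDerivAt B (deriv B x) x := fun x =>
    (hB.differentiable one_ne_zero x).hasDerivAt
  have φ1 : ∀ z : ℝ × ℝ, fderiv ℝ φ z (1, 0) = deriv A (z.2 + z.1) - deriv B (z.2 - z.1) :=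
    fun z => (hasDerivAt_slice_fst cφ z.1 z.2).unique
      (((dA _).comp_const_add z.2 z.1).add ((dB _).comp_const_sub z.2 z.1))
  have ψ1 : ∀ z : ℝ × ℝ, fderiv ℝ ψ z (1, 0) = deriv A (z.2 + z.1) + deriv B (z.2 - z.1) :=
    fun z => by
      have := (hasDerivAt_slice_fst cψ z.1 z.2).unique
        (((dA _).comp_const_add z.2 z.1).sub ((dB _).comp_const_sub z.2 z.1))
      rw [this, sub_neg_eq_add]
  have φ2 : ∀ z : ℝ × ℝ, fderiv ℝ φ z (0, 1) = deriv A (z.2 + z.1) + deriv B (z.2 - z.1) :=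
    fun z => (hasDerivAt_slice_snd cφ z.1 z.2).unique
      (((dA _).comp_add_const z.2 z.1).add ((dB _).comp_sub_const z.2 z.1))
  have ψ2 : ∀ z : ℝ × ℝ, fderiv ℝ ψ z (0, 1) = deriv A (z.2 + z.1) - deriv B (z.2 - z.1) :=
    fun z => (hasDerivAt_slice_snd cψ z.1 z.2).unique
      (((dA _).comp_add_const z.2 z.1).sub ((dB _).comp_sub_const z.2 z.1))
  have cu := contDiff_volterraTransform hKL.contDiff_fst cφ
  have cv := contDiff_volterraTransform hKL.contDiff_snd cψ
  have du : ∀ z, HasFDerivAt (fun z => 1 / 2 * volterraTransform K φ z) _ z := fun z =>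
    (cu.differentiable one_ne_zero z).hasFDerivAt.const_mul (1 / 2)
  have dv : ∀ z, HasFDerivAt (fun z => 1 / 2 * volterraTransform L ψ z) _ z := fun z =>
    (cv.differentiable one_ne_zero z).hasFDerivAt.const_mul (1 / 2)
  refine ⟨r, fun z => 1 / 2 * volterraTransform K φ z, fun z => 1 / 2 * volterraTransform L ψ z,
    by fun_prop, by fun_prop, hr hξ₀, fun z => ?_, fun z => ?_, ?_⟩
  · rw [(du z).fderiv, (dv z).fderiv]
    have := hKL.volterraTransform_intertwine cφ cψ (fun z => by rw [φ1, ψ2]) z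
    simp only [_root_.smul_apply, smul_eq_mul]
    linear_combination this / 2
  · rw [(du z).fderiv, (dv z).fderiv]
    have := hLK.volterraTransform_intertwine cψ cφ (fun z => by rw [ψ1, φ2]) z
    simp only [_root_.smul_apply, smul_eq_mul]
    push_cast at this
    linear_combination this / 2
  · have t0 : Tendsto Prod.fst (𝓝[cauchyDomain J S] z₀) (𝓝[J] z₀.1) :=
      continuousWithinAt_fst.tendsto_nhdsWithin fun w hw => hw.1
    have t1 : Tendsto (fun z : ℝ × ℝ => z.2 - z.1) (𝓝[cauchyDomain J S] z₀)
        (𝓝[S] (z₀.2 - z₀.1)) :=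
      (by fun_prop : Continuous fun z : ℝ × ℝ => z.2 - z.1).continuousWithinAt.tendsto_nhdsWithin
        fun w hw => hw.2.1
    have t2 : Tendsto (fun z : ℝ × ℝ => z.2 + z.1) (𝓝[cauchyDomain J S] z₀)
        (𝓝[S] (z₀.2 + z₀.1)) :=
      (by fun_prop : Continuous fun z : ℝ × ℝ => z.2 + z.1).continuousWithinAt.tendsto_nhdsWithin
        fun w hw => hw.2.2
    filter_upwards [t0 hJn, t1 hn₁, t2 hn₂] with z hz hz1 hz2
    have hz1' := Icc_subset_Icc (min_le_left a₁ a₂) (le_max_left b₁ b₂) hz1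
    have hz2' := Icc_subset_Icc (min_le_right a₁ a₂) (le_max_right b₁ b₂) hz2
    rw [vekuaFormula_re, vekuaFormula_im]
    constructor
    · rw [transmutation_eq_volterraTransform eK hz ordConnected_Icc hz1' hz2' (φ := φ)]
      intro τ h1 h2
      simp only [hφ, (eA _ h2).1, (eB _ h1).1]
    · rw [transmutation_eq_volterraTransform eL hz ordConnected_Icc hz1' hz2' (φ := ψ)]
      intro τ h1 h2
      simp only [hψ, (eA _ h2).1, (eB _ h1).1]

theorem isVekuaSolution_vekuaFormula (hf : IsAdmissible J f) (hS : S.OrdConnected)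
    (hSn : S.Nontrivial) (hW₀ : C1On W₀ S) :
    IsVekuaSolution J S f W₀ (vekuaFormula J f W₀) := by
  have hu := cauchyDomain_uniqueDiffOn hf.ordConnected hf.nontrivial hf.zero_mem hS hSn
  refine ⟨⟨fun z hz => ?_, fun z hz => ?_⟩, fun z hz => ?_, fun t ht => ?_⟩
  · obtain ⟨r, u, v, cu, cv, -, -, -, he⟩ := exists_local_solution hf hS hSn hW₀ hz
    exact cu.contDiffAt.contDiffWithinAt.congr_of_eventuallyEq (he.mono fun _ h => h.1)
      (he.self_of_nhdsWithin hz).1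
  · obtain ⟨r, u, v, cu, cv, -, -, -, he⟩ := exists_local_solution hf hS hSn hW₀ hz
    exact cv.contDiffAt.contDiffWithinAt.congr_of_eventuallyEq (he.mono fun _ h => h.2)
      (he.self_of_nhdsWithin hz).2
  · obtain ⟨r, u, v, cu, cv, hr, h1, h2, he⟩ := exists_local_solution hf hS hSn hW₀ hz
    have e1 : (fun q => (vekuaFormula J f W₀ q).re) =ᶠ[𝓝[cauchyDomain J S] z] u :=
      he.mono fun _ h => h.1
    have e2 : (fun q => (vekuaFormula J f W₀ q).im) =ᶠ[𝓝[cauchyDomain J S] z] v :=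
      he.mono fun _ h => h.2
    have hz' := he.self_of_nhdsWithin hz
    rw [vekua_equation_iff, e1.fderivWithin_eq hz'.1, e2.fderivWithin_eq hz'.2,
      fderivWithin_eq_fderiv (hu z hz) (cu.differentiable one_ne_zero z),
      fderivWithin_eq_fderiv (hu z hz) (cv.differentiable one_ne_zero z), hz'.1, hz'.2, ← hr]
    exact ⟨h1 z, h2 z⟩
  · ext
    · rw [vekuaFormula_re]
      simp [transmutation, plus, minus]
      ring
    · rw [vekuaFormula_im]
      simp [transmutation, plus, minus]
      ring

end VekuaFormula

/-! ### Uniqueness by estimates along characteristics -/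

section VekuaUniqueness

theorem norm_le_exp_of_hasDerivWithinAt {g g' : ℝ → ℂ} {C l s : ℝ} (hl : 0 < l) (hC : 0 ≤ C)
    (hg : ∀ σ ∈ uIcc 0 s, HasDerivWithinAt g (g' σ) (uIcc 0 s) σ)
    (hg' : ContinuousOn g' (uIcc 0 s)) (h0 : g 0 = 0)
    (hb : ∀ σ ∈ uIcc 0 s, ‖g' σ‖ ≤ C * Real.exp (l * |σ|)) :
    ‖g s‖ ≤ C * Real.exp (l * |s|) / l := by
  have hint : ∫ σ in (0 : ℝ)..s, g' σ = g s := by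
    rw [intervalIntegral.integral_eq_sub_of_hasDeriv_right
      (fun σ hσ => (hg σ hσ).continuousWithinAt)
      (fun σ hσ => ((hg σ (Ioo_subset_Icc_self hσ)).hasDerivAt
        (Icc_mem_nhds hσ.1 hσ.2)).hasDerivWithinAt) hg'.intervalIntegrable, h0, sub_zero]
  rw [← hint]
  exact norm_integral_le_exp hl hC hb

/-- The backward triangle with apex `z₀`. -/
def backwardTriangle (z₀ : ℝ × ℝ) : Set (ℝ × ℝ) :=
  {z | z.1 ∈ uIcc 0 z₀.1 ∧ |z.2 - z₀.2| ≤ |z₀.1| - |z.1|}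

theorem isCompact_backwardTriangle (z₀ : ℝ × ℝ) : IsCompact (backwardTriangle z₀) := by
  refine (isCompact_uIcc.prod (isCompact_closedBall z₀.2 |z₀.1|)).of_isClosed_subset
    (s := uIcc 0 z₀.1 ×ˢ Metric.closedBall z₀.2 |z₀.1|) ?_ fun z hz => ⟨hz.1, ?_⟩
  · exact (isClosed_Icc.preimage continuous_fst).inter
      (isClosed_le (by fun_prop : Continuous fun z : ℝ × ℝ => |z.2 - z₀.2|) (by fun_prop))
  · rw [Metric.mem_closedBall, Real.dist_eq]
    linarith [hz.2, abs_nonneg z.1]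

theorem self_mem_backwardTriangle (z₀ : ℝ × ℝ) : z₀ ∈ backwardTriangle z₀ :=
  ⟨right_mem_uIcc, by simp⟩

theorem abs_sub_eq_of_mem_uIcc_zero {s σ : ℝ} (h : σ ∈ uIcc 0 s) : |s - σ| = |s| - |σ| := by
  rcases le_total 0 s with hs | hs
  · rw [uIcc_of_le hs] at h
    rw [abs_of_nonneg hs, abs_of_nonneg h.1, abs_of_nonneg (by linarith [h.2])]
  · rw [uIcc_of_ge hs] at h
    rw [abs_of_nonpos hs, abs_of_nonpos h.2, abs_of_nonpos (by linarith [h.1])]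
    ring

theorem characteristic_mem_backwardTriangle {z₀ z : ℝ × ℝ} (hz : z ∈ backwardTriangle z₀)
    {e : ℝ} (he : |e| = 1) {σ : ℝ} (hσ : σ ∈ uIcc 0 z.1) :
    (σ, z.2 + e * (σ - z.1)) ∈ backwardTriangle z₀ := by
  refine ⟨uIcc_subset_uIcc left_mem_uIcc hz.1 hσ, ?_⟩
  have h1 := abs_add_le (z.2 - z₀.2) (e * (σ - z.1))
  rw [abs_mul, he, one_mul, abs_sub_comm σ, abs_sub_eq_of_mem_uIcc_zero hσ] at h1
  have h2 : z.2 + e * (σ - z.1) - z₀.2 = z.2 - z₀.2 + e * (σ - z.1) := by ring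
  simp only [h2]
  linarith [hz.2]

variable {J S : Set ℝ} {f : ℝ → ℝ} {W₀ : ℝ → Bicomplex} {W : ℝ × ℝ → Bicomplex}

/-- Every point of the triangle has both characteristic feet between z₀.2 - z₀.1 and z₀.2 + z₀.1,
and `S` is an interval. -/
theorem backwardTriangle_subset (hJ : J.OrdConnected) (h0 : (0 : ℝ) ∈ J) (hS : S.OrdConnected)
    {z₀ : ℝ × ℝ} (hz₀ : z₀ ∈ cauchyDomain J S) : backwardTriangle z₀ ⊆ cauchyDomain J S := by
  intro z hz
  have h2 := abs_le.1 hz.2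
  have hS' : ∀ y, |y - z₀.2| ≤ |z₀.1| → y ∈ S := by
    intro y hy
    rw [abs_le] at hy
    rcases le_total 0 z₀.1 with h | h
    · rw [abs_of_nonneg h] at hy
      exact hS.out hz₀.2.1 hz₀.2.2 ⟨by linarith [hy.1], by linarith [hy.2]⟩
    · rw [abs_of_nonpos h] at hy
      exact hS.out hz₀.2.2 hz₀.2.1 ⟨by linarith [hy.1], by linarith [hy.2]⟩
  refine ⟨uIcc_zero_subset hJ h0 hz₀.1 hz.1, hS' _ ?_, hS' _ ?_⟩ <;>
  · rw [abs_le]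
    constructor <;> linarith [neg_abs_le z.1, le_abs_self z.1]

/-- On the line of slope `e` through `z`, the function `w` starts from 0 at ξ = 0 and has derivative
r w'. The segment stays in the triangle, so the weighted bound on w' integrates with the gain 1 / l.
-/
theorem norm_le_along_characteristic {D : Set (ℝ × ℝ)} {z₀ z : ℝ × ℝ}
    (hT : backwardTriangle z₀ ⊆ D) (hz : z ∈ backwardTriangle z₀) {e : ℝ} (he : |e| = 1)
    {w w' : ℝ × ℝ → ℂ} {r : ℝ → ℝ} {B N l : ℝ} (hl : 0 < l) (hB0 : 0 ≤ B) (hN : 0 ≤ N)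
    (hr : ContinuousOn r (uIcc 0 z₀.1)) (hB : ∀ s ∈ uIcc 0 z₀.1, ‖r s‖ ≤ B)
    (hw : DifferentiableOn ℝ w D) (hw' : ContinuousOn w' D)
    (heq : ∀ p ∈ D, fderivWithin ℝ w D p (1, e) = r p.1 * w' p)
    (h0 : ∀ t, (0, t) ∈ backwardTriangle z₀ → w (0, t) = 0)
    (hb : ∀ p ∈ backwardTriangle z₀, ‖w' p‖ ≤ N * Real.exp (l * |p.1|)) :
    ‖w z‖ ≤ B * N * Real.exp (l * |z.1|) / l := by
  have hmem : ∀ σ ∈ uIcc 0 z.1, (σ, z.2 + e * (σ - z.1)) ∈ backwardTriangle z₀ :=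
    fun σ hσ => characteristic_mem_backwardTriangle hz he hσ
  have hc : ContinuousOn (fun σ : ℝ => (σ, z.2 + e * (σ - z.1))) (uIcc 0 z.1) := by fun_prop
  have key := norm_le_exp_of_hasDerivWithinAt (g := fun σ => w (σ, z.2 + e * (σ - z.1)))
    (g' := fun σ => r σ * w' (σ, z.2 + e * (σ - z.1))) (s := z.1) (C := B * N) hl
    (by positivity) (fun σ hσ => ?_) ?_ (h0 _ (hmem 0 left_mem_uIcc)) fun σ hσ => ?_
  · simpa using key
  · have h1 : HasDerivWithinAt (fun σ : ℝ => (σ, z.2 + e * (σ - z.1))) (1, e) (uIcc 0 z.1) σ := by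
      refine (hasDerivWithinAt_id σ _).prodMk ?_
      simpa using (((hasDerivWithinAt_id σ (uIcc 0 z.1)).sub_const z.1).const_mul e).const_add z.2
    have := (hw _ (hT (hmem σ hσ))).hasFDerivWithinAt.comp_hasDerivWithinAt σ h1
      fun σ hσ => hT (hmem σ hσ)
    rwa [heq _ (hT (hmem σ hσ))] at this
  · refine ContinuousOn.mul ?_ (hw'.comp hc fun σ hσ => hT (hmem σ hσ))
    exact Complex.continuous_ofReal.comp_continuousOn
      (hr.mono (uIcc_subset_uIcc left_mem_uIcc hz.1))
  · rw [norm_mul, Complex.norm_real, mul_assoc]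
    exact mul_le_mul (hB σ (uIcc_subset_uIcc left_mem_uIcc hz.1 hσ)) (hb _ (hmem σ hσ))
      (norm_nonneg _) hB0

/-- At a maximum point of exp(-l |ξ|)(‖w‖ + ‖w'‖) on the compact triangle, the two characteristic
estimates bound the maximum by 2B / l times itself. Since l = 2B + 1, it vanishes. -/
theorem characteristic_system_unique (hJ : J.OrdConnected) (h0 : (0 : ℝ) ∈ J)
    (hS : S.OrdConnected) {w w' : ℝ × ℝ → ℂ} {r : ℝ → ℝ} (hr : ContinuousOn r J)
    (hw : DifferentiableOn ℝ w (cauchyDomain J S)) (hw' : DifferentiableOn ℝ w' (cauchyDomain J S))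
    (h₁ : ∀ p ∈ cauchyDomain J S,
      fderivWithin ℝ w (cauchyDomain J S) p (1, -1) = r p.1 * w' p)
    (h₂ : ∀ p ∈ cauchyDomain J S,
      fderivWithin ℝ w' (cauchyDomain J S) p (1, 1) = r p.1 * w p)
    (i₁ : ∀ t ∈ S, w (0, t) = 0) (i₂ : ∀ t ∈ S, w' (0, t) = 0)
    {z₀ : ℝ × ℝ} (hz₀ : z₀ ∈ cauchyDomain J S) : w z₀ = 0 ∧ w' z₀ = 0 := by
  have hT := backwardTriangle_subset hJ h0 hS hz₀
  have hrT := hr.mono (uIcc_zero_subset hJ h0 hz₀.1)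
  obtain ⟨B, hB⟩ := isCompact_uIcc.exists_bound_of_continuousOn hrT
  have hB0 : 0 ≤ B := (norm_nonneg _).trans (hB 0 left_mem_uIcc)
  set l : ℝ := 2 * B + 1 with hl
  have hl0 : 0 < l := by positivity
  have cT : ContinuousOn (fun z : ℝ × ℝ => Real.exp (-(l * |z.1|)) * (‖w z‖ + ‖w' z‖))
      (backwardTriangle z₀) :=
    ContinuousOn.mul (by fun_prop)
      ((hw.continuousOn.mono hT).norm.add (hw'.continuousOn.mono hT).norm)
  obtain ⟨z, hz, hmax⟩ := (isCompact_backwardTriangle z₀).exists_isMaxOn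
    ⟨z₀, self_mem_backwardTriangle z₀⟩ cT
  set N := Real.exp (-(l * |z.1|)) * (‖w z‖ + ‖w' z‖) with hN
  have hN0 : 0 ≤ N := by positivity
  have hle : ∀ p ∈ backwardTriangle z₀, ‖w p‖ + ‖w' p‖ ≤ N * Real.exp (l * |p.1|) :=
    fun p hp => by
      have := hmax hp
      simp only [mem_ofPred_eq] at this
      calc ‖w p‖ + ‖w' p‖ =
            Real.exp (-(l * |p.1|)) * (‖w p‖ + ‖w' p‖) * Real.exp (l * |p.1|) := by
            rw [Real.exp_neg]; field_simp
        _ ≤ _ := by gcongr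
  have hi : ∀ t, (0, t) ∈ backwardTriangle z₀ → t ∈ S := fun t ht => by
    simpa using (hT ht).2.1
  have e₁ := norm_le_along_characteristic hT hz (e := -1) (by simp) hl0 hB0 hN0 hrT hB hw
    hw'.continuousOn h₁ (fun t ht => i₁ t (hi t ht))
    fun p hp => (le_add_of_nonneg_left (norm_nonneg _)).trans (hle p hp)
  have e₂ := norm_le_along_characteristic hT hz (e := 1) (by simp) hl0 hB0 hN0 hrT hB hw'
    hw.continuousOn h₂ (fun t ht => i₂ t (hi t ht))
    fun p hp => (le_add_of_nonneg_right (norm_nonneg _)).trans (hle p hp)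
  have hNle : N ≤ 0 := by
    have h2 : N ≤ 2 * B * N / l := by
      calc N ≤ Real.exp (-(l * |z.1|)) * (B * N * Real.exp (l * |z.1|) / l +
            B * N * Real.exp (l * |z.1|) / l) := by
            rw [hN]; gcongr
        _ = _ := by rw [Real.exp_neg]; field_simp; ring
    rw [le_div_iff₀ hl0, hl] at h2
    linarith
  have := hle z₀ (self_mem_backwardTriangle z₀)
  rw [le_antisymm hNle hN0, zero_mul] at this
  exact ⟨norm_le_zero_iff.1 (by linarith [norm_nonneg (w' z₀)]),
    norm_le_zero_iff.1 (by linarith [norm_nonneg (w z₀)])⟩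

theorem IsVekuaSolution.unique {W₁ W₂ : ℝ × ℝ → Bicomplex} (hf : IsAdmissible J f)
    (hS : S.OrdConnected) (hSn : S.Nontrivial) (h₁ : IsVekuaSolution J S f W₀ W₁)
    (h₂ : IsVekuaSolution J S f W₀ W₂) : EqOn W₁ W₂ (cauchyDomain J S) := by
  have hu := cauchyDomain_uniqueDiffOn hf.ordConnected hf.nontrivial hf.zero_mem hS hSn
  have d1 := h₁.contDiff.1.differentiableOn one_ne_zero
  have d2 := h₁.contDiff.2.differentiableOn one_ne_zero
  have d3 := h₂.contDiff.1.differentiableOn one_ne_zero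
  have d4 := h₂.contDiff.2.differentiableOn one_ne_zero
  have fp : ∀ p ∈ cauchyDomain J S, HasFDerivWithinAt
      (fun p => ((W₁ p).re - (W₂ p).re) + ((W₁ p).im - (W₂ p).im)) _ (cauchyDomain J S) p :=
    fun p hp => ((d1 p hp).hasFDerivWithinAt.sub (d3 p hp).hasFDerivWithinAt).add
      ((d2 p hp).hasFDerivWithinAt.sub (d4 p hp).hasFDerivWithinAt)
  have fm : ∀ p ∈ cauchyDomain J S, HasFDerivWithinAt
      (fun p => ((W₁ p).re - (W₂ p).re) - ((W₁ p).im - (W₂ p).im)) _ (cauchyDomain J S) p :=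
    fun p hp => ((d1 p hp).hasFDerivWithinAt.sub (d3 p hp).hasFDerivWithinAt).sub
      ((d2 p hp).hasFDerivWithinAt.sub (d4 p hp).hasFDerivWithinAt)
  have s1 : ((1, 1) : ℝ × ℝ) = (1, 0) + (0, 1) := by simp
  have s2 : ((1, -1) : ℝ × ℝ) = (1, 0) - (0, 1) := by simp
  intro z hz
  -- The Riemann invariants: adding and subtracting the component equations leaves a single
  -- directional derivative in each, with coefficient p.
  have key := characteristic_system_unique hf.ordConnected hf.zero_mem hS
    (w := fun p => ((W₁ p).re - (W₂ p).re) + ((W₁ p).im - (W₂ p).im))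
    (w' := fun p => ((W₁ p).re - (W₂ p).re) - ((W₁ p).im - (W₂ p).im))
    (r := logDerivWithin J f) hf.contDiffOn_logDerivWithin.continuousOn
    (fun p hp => (fp p hp).differentiableWithinAt) (fun p hp => (fm p hp).differentiableWithinAt)
    (fun p hp => ?_) (fun p hp => ?_) (fun t ht => ?_) (fun t ht => ?_) hz
  · have e1 : (W₁ z).re = (W₂ z).re := by linear_combination (key.1 + key.2) / 2
    have e2 : (W₁ z).im = (W₂ z).im := by linear_combination (key.1 - key.2) / 2
    exact QuadraticAlgebra.ext e1 e2
  · obtain ⟨a1, a2⟩ := vekua_equation_iff.1 (h₁.equation p hp)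
    obtain ⟨b1, b2⟩ := vekua_equation_iff.1 (h₂.equation p hp)
    rw [(fp p hp).fderivWithin (hu p hp), s2]
    simp only [map_sub, _root_.add_apply, _root_.sub_apply]
    linear_combination a1 - b1 + a2 - b2
  · obtain ⟨a1, a2⟩ := vekua_equation_iff.1 (h₁.equation p hp)
    obtain ⟨b1, b2⟩ := vekua_equation_iff.1 (h₂.equation p hp)
    rw [(fm p hp).fderivWithin (hu p hp), s1]
    simp only [map_add, _root_.sub_apply]
    linear_combination a1 - b1 - a2 + b2
  · simp only [h₁.initial t ht, h₂.initial t ht, sub_self, add_zero]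
  · simp only [h₁.initial t ht, h₂.initial t ht, sub_self]

end VekuaUniqueness

/-! ### The travel time coordinate and the impedance factor of a medium -/

section Medium

/-- The primitive of a continuous function on an interval is differentiable within it. -/
theorem hasDerivWithinAt_primitive {X : Set ℝ} (hX : X.OrdConnected) (h0 : (0 : ℝ) ∈ X)
    {h : ℝ → ℝ} (hh : ContinuousOn h X) {x : ℝ} (hx : x ∈ X) :
    HasDerivWithinAt (fun x => ∫ s in (0 : ℝ)..x, h s) (h x) X x := by
  obtain ⟨α, β, hsub, hxI, h0I, hn⟩ := exists_compact_interval_nhdsWithin hX hx h0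
  have hle := hxI.1.trans hxI.2
  set h' : ℝ → ℝ := fun s => h (max α (min β s)) with hh'
  have hc : Continuous h' := hh.comp_continuous (by fun_prop) fun s =>
    hsub ⟨le_max_left _ _, max_le hle (min_le_left _ _)⟩
  have he : ∀ s ∈ Icc α β, h' s = h s := fun s hs => by
    simp only [hh', min_eq_right hs.2, max_eq_right hs.1]
  have hint : ∀ y ∈ Icc α β, ∫ s in (0 : ℝ)..y, h s = ∫ s in (0 : ℝ)..y, h' s := fun y hy =>
    intervalIntegral.integral_congr fun s hs => (he s (ordConnected_Icc.uIcc_subset h0I hy hs)).symm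
  have hd := intervalIntegral.integral_hasDerivAt_right (hc.intervalIntegrable 0 x)
    (hc.stronglyMeasurableAtFilter _ _) hc.continuousAt
  rw [he x hxI] at hd
  exact hd.hasDerivWithinAt.congr_of_eventuallyEq (mem_of_superset hn hint) (hint x hxI)

/-- The inverse of a strictly increasing function on an interval is continuous. -/
theorem continuousOn_of_leftInvOn_strictMonoOn {X : Set ℝ} (hX : X.OrdConnected) {φ g : ℝ → ℝ}
    (hφ : StrictMonoOn φ X) (hJ : (φ '' X).OrdConnected) (hg : LeftInvOn g φ X) :
    ContinuousOn g (φ '' X) := by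
  have := hX
  have := hJ
  rw [continuousOn_iff_continuous_domRestrict]
  have e : (φ '' X).domRestrict g = fun y => ((hφ.orderIso φ X).symm y : ℝ) := by
    ext y
    obtain ⟨x, rfl⟩ := (hφ.orderIso φ X).surjective y
    rw [OrderIso.symm_apply_apply]
    exact hg x.2
  rw [e]
  exact continuous_subtype_val.comp (hφ.orderIso φ X).symm.continuous

/-- The form relative to sets covers endpoints of the intervals, where only one-sided derivatives
exist. -/
theorem HasDerivWithinAt.of_leftInverse {s t : Set ℝ} {φ g : ℝ → ℝ} {φ' a : ℝ}
    (hg : Tendsto g (𝓝[s] a) (𝓝[t] (g a))) (hφ : HasDerivWithinAt φ φ' t (g a)) (hφ' : φ' ≠ 0)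
    (ha : a ∈ s) (hφg : ∀ x ∈ s, φ (g x) = x) : HasDerivWithinAt g φ'⁻¹ s a := by
  have h : HasFDerivWithinAt φ
      ((ContinuousLinearEquiv.unitsEquivAut ℝ (Units.mk0 φ' hφ') : ℝ ≃L[ℝ] ℝ) : ℝ →L[ℝ] ℝ) t
      (g a) := by
    refine hφ.hasFDerivWithinAt.congr_fderiv ?_
    ext
    simp
  have h2 := h.of_local_left_inverse hg ha (mem_of_superset self_mem_nhdsWithin hφg)
  refine h2.hasDerivWithinAt.congr_deriv ?_
  simp

/-- The assumptions on an inhomogeneous medium. -/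
structure IsMedium (X : Set ℝ) (ε : ℝ → ℝ) (μ : ℝ) : Prop where
  ordConnected : X.OrdConnected
  nontrivial : X.Nontrivial
  zero_mem : (0 : ℝ) ∈ X
  contDiffOn : ContDiffOn ℝ 2 ε X
  eps_pos : ∀ x ∈ X, 0 < ε x
  mu_pos : 0 < μ

namespace IsMedium

variable {X : Set ℝ} {ε : ℝ → ℝ} {μ : ℝ} {f : ℝ → ℝ}

theorem travelTime_zero : travelTime ε μ 0 = 0 := by simp [travelTime]

theorem contDiffOn_slowness (h : IsMedium X ε μ) : ContDiffOn ℝ 2 (fun x => √μ * √(ε x)) X :=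
  contDiffOn_const.mul (h.contDiffOn.sqrt fun x hx => (h.eps_pos x hx).ne')

theorem slowness_pos (h : IsMedium X ε μ) {x : ℝ} (hx : x ∈ X) : 0 < √μ * √(ε x) :=
  mul_pos (Real.sqrt_pos.2 h.mu_pos) (Real.sqrt_pos.2 (h.eps_pos x hx))

theorem hasDerivWithinAt_travelTime (h : IsMedium X ε μ) {x : ℝ} (hx : x ∈ X) :
    HasDerivWithinAt (travelTime ε μ) (√μ * √(ε x)) X x :=
  (hasDerivWithinAt_primitive h.ordConnected h.zero_mem
    (Real.continuous_sqrt.comp_continuousOn h.contDiffOn.continuousOn) hx).const_mul _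

theorem strictMonoOn_travelTime (h : IsMedium X ε μ) : StrictMonoOn (travelTime ε μ) X := by
  refine strictMonoOn_of_deriv_pos h.ordConnected.convex
    (fun x hx => (h.hasDerivWithinAt_travelTime hx).continuousWithinAt) fun x hx => ?_
  rw [((h.hasDerivWithinAt_travelTime (interior_subset hx)).hasDerivAt
    (mem_interior_iff_mem_nhds.1 hx)).deriv]
  exact h.slowness_pos (interior_subset hx)

theorem ordConnected_image (h : IsMedium X ε μ) : (travelTime ε μ '' X).OrdConnected :=
  (h.ordConnected.isPreconnected.image _ fun _ hx =>
    (h.hasDerivWithinAt_travelTime hx).continuousWithinAt).ordConnected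

theorem nontrivial_image (h : IsMedium X ε μ) : (travelTime ε μ '' X).Nontrivial :=
  h.nontrivial.image_of_injOn h.strictMonoOn_travelTime.injOn

theorem zero_mem_image (h : IsMedium X ε μ) : (0 : ℝ) ∈ travelTime ε μ '' X :=
  ⟨0, h.zero_mem, travelTime_zero⟩

theorem contDiffOn_travelTime (h : IsMedium X ε μ) : ContDiffOn ℝ 1 (travelTime ε μ) X := by
  have hu := interval_uniqueDiffOn h.ordConnected h.nontrivial
  rw [contDiffOn_one_iff_derivWithin hu]
  refine ⟨fun x hx => (h.hasDerivWithinAt_travelTime hx).differentiableWithinAt, ?_⟩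
  exact h.contDiffOn_slowness.continuousOn.congr fun x hx =>
    (h.hasDerivWithinAt_travelTime hx).derivWithin (hu x hx)

/-- The position as a function of the travel time. -/
def position (X : Set ℝ) (ε : ℝ → ℝ) (μ : ℝ) : ℝ → ℝ := Function.invFunOn (travelTime ε μ) X

theorem position_travelTime (h : IsMedium X ε μ) : LeftInvOn (position X ε μ) (travelTime ε μ) X :=
  h.strictMonoOn_travelTime.injOn.leftInvOn_invFunOn

theorem position_mem {y : ℝ} (hy : y ∈ travelTime ε μ '' X) : position X ε μ y ∈ X :=
  Function.invFunOn_mem hy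

theorem travelTime_position {y : ℝ} (hy : y ∈ travelTime ε μ '' X) :
    travelTime ε μ (position X ε μ y) = y :=
  Function.invFunOn_eq hy

theorem hasDerivWithinAt_position (h : IsMedium X ε μ) {y : ℝ} (hy : y ∈ travelTime ε μ '' X) :
    HasDerivWithinAt (position X ε μ) (√μ * √(ε (position X ε μ y)))⁻¹ (travelTime ε μ '' X) y :=
  HasDerivWithinAt.of_leftInverse
    (((continuousOn_of_leftInvOn_strictMonoOn h.ordConnected h.strictMonoOn_travelTime
      h.ordConnected_image h.position_travelTime) y hy).tendsto_nhdsWithin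
        fun _ hx => position_mem hx)
    (h.hasDerivWithinAt_travelTime (position_mem hy)) (h.slowness_pos (position_mem hy)).ne' hy
    fun _ hx => travelTime_position hx

/-- A bootstrap: the derivative of the inverse is the reciprocal slowness composed with the inverse.
Continuity of the inverse gives C¹, and C¹ then gives C². -/
theorem contDiffOn_position (h : IsMedium X ε μ) :
    ContDiffOn ℝ 2 (position X ε μ) (travelTime ε μ '' X) := by
  have hu := interval_uniqueDiffOn h.ordConnected_image h.nontrivial_image
  have hd : DifferentiableOn ℝ (position X ε μ) (travelTime ε μ '' X) := fun y hy =>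
    (h.hasDerivWithinAt_position hy).differentiableWithinAt
  have he : EqOn (derivWithin (position X ε μ) (travelTime ε μ '' X))
      (fun y => (√μ * √(ε (position X ε μ y)))⁻¹) (travelTime ε μ '' X) := fun y hy =>
    (h.hasDerivWithinAt_position hy).derivWithin (hu y hy)
  have hm : MapsTo (position X ε μ) (travelTime ε μ '' X) X := fun _ hx => position_mem hx
  have hs : ContDiffOn ℝ 2 (fun x => (√μ * √(ε x))⁻¹) X :=
    h.contDiffOn_slowness.inv fun x hx => (h.slowness_pos hx).ne'
  have h1 : ContDiffOn ℝ 1 (position X ε μ) (travelTime ε μ '' X) :=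
    (contDiffOn_one_iff_derivWithin hu).2
      ⟨hd, (hs.continuousOn.comp hd.continuousOn hm).congr he⟩
  rw [show (2 : WithTop ℕ∞) = 1 + 1 by norm_num, contDiffOn_succ_iff_derivWithin hu]
  exact ⟨hd, by simp, ((hs.of_le (by norm_num)).comp h1 hm).congr he⟩

theorem waveSpeed_pos (h : IsMedium X ε μ) {x : ℝ} (hx : x ∈ X) : 0 < waveSpeed ε μ x :=
  one_div_pos.2 (Real.sqrt_pos.2 (mul_pos (h.eps_pos x hx) h.mu_pos))

theorem contDiffOn_waveSpeed (h : IsMedium X ε μ) : ContDiffOn ℝ 2 (waveSpeed ε μ) X := by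
  have hp : ∀ x ∈ X, ε x * μ ≠ 0 := fun x hx => (mul_pos (h.eps_pos x hx) h.mu_pos).ne'
  exact contDiffOn_const.div ((h.contDiffOn.mul contDiffOn_const).sqrt hp) fun x hx =>
    (Real.sqrt_pos.2 (mul_pos (h.eps_pos x hx) h.mu_pos)).ne'

/-- The coefficient of the Vekua equation that corresponds to a medium is admissible. -/
theorem isAdmissible (h : IsMedium X ε μ)
    (hf : ∀ x ∈ X, f (travelTime ε μ x) = √(waveSpeed ε μ 0) / √(waveSpeed ε μ x)) :
    IsAdmissible (travelTime ε μ '' X) f where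
  ordConnected := h.ordConnected_image
  nontrivial := h.nontrivial_image
  zero_mem := h.zero_mem_image
  contDiffOn := by
    have hs : ContDiffOn ℝ 2 (fun x => √(waveSpeed ε μ 0) / √(waveSpeed ε μ x)) X :=
      contDiffOn_const.div (h.contDiffOn_waveSpeed.sqrt fun x hx => (h.waveSpeed_pos hx).ne')
        fun x hx => (Real.sqrt_pos.2 (h.waveSpeed_pos hx)).ne'
    refine (hs.comp h.contDiffOn_position fun _ hx => position_mem hx).congr fun y hy => ?_
    rw [Function.comp_apply, ← hf _ (position_mem hy), travelTime_position hy]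
  ne_zero := by
    rintro _ ⟨x, hx, rfl⟩
    rw [hf x hx]
    exact (div_pos (Real.sqrt_pos.2 (h.waveSpeed_pos h.zero_mem))
      (Real.sqrt_pos.2 (h.waveSpeed_pos hx))).ne'
  map_zero := by
    have := hf 0 h.zero_mem
    rwa [travelTime_zero, div_self (Real.sqrt_pos.2 (h.waveSpeed_pos h.zero_mem)).ne'] at this

theorem sqrt_waveSpeed_sq (h : IsMedium X ε μ) {x : ℝ} (hx : x ∈ X) :
    √(waveSpeed ε μ x) ^ 2 * √(ε x) * √μ = 1 := by
  rw [Real.sq_sqrt (h.waveSpeed_pos hx).le, waveSpeed, Real.sqrt_mul (h.eps_pos x hx).le]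
  have h1 := Real.sqrt_pos.2 (h.eps_pos x hx)
  have h2 := Real.sqrt_pos.2 h.mu_pos
  field_simp

/-- The factor by which `E` is multiplied in the components of `W`; `i H` is divided by it. -/
def impedance (ε : ℝ → ℝ) (μ x : ℝ) : ℝ := √(waveSpeed ε μ x) * √(ε x)

/-- Because c √ε √μ = 1, the coefficients of E and iH in W are reciprocal, so one factor F describes
both. -/
theorem impedance_inv (h : IsMedium X ε μ) {x : ℝ} (hx : x ∈ X) :
    √(waveSpeed ε μ x) * √μ = (impedance ε μ x)⁻¹ := by
  refine eq_inv_of_mul_eq_one_left ?_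
  rw [← h.sqrt_waveSpeed_sq hx, impedance]
  ring

/-- F = √c √ε equals 1 / (√μ √c), a constant multiple of f. Its logarithmic derivative in ξ is
therefore f'/f, the Vekua coefficient. -/
theorem impedance_eq (h : IsMedium X ε μ)
    (hf : ∀ x ∈ X, f (travelTime ε μ x) = √(waveSpeed ε μ 0) / √(waveSpeed ε μ x)) {x : ℝ}
    (hx : x ∈ X) :
    impedance ε μ x = (√μ * √(waveSpeed ε μ 0))⁻¹ * f (travelTime ε μ x) := by
  have h1 := Real.sqrt_pos.2 h.mu_pos
  have h2 := Real.sqrt_pos.2 (h.waveSpeed_pos h.zero_mem)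
  have h3 := Real.sqrt_pos.2 (h.waveSpeed_pos hx)
  have h4 := h.sqrt_waveSpeed_sq hx
  rw [hf x hx, impedance]
  field_simp
  linear_combination h4

theorem slowness_eq_mul_impedance_sq (h : IsMedium X ε μ) {x : ℝ} (hx : x ∈ X) :
    √μ * √(ε x) = μ * impedance ε μ x ^ 2 := by
  have h4 := h.sqrt_waveSpeed_sq hx
  have h5 := Real.sq_sqrt h.mu_pos.le
  rw [impedance]
  linear_combination √(waveSpeed ε μ x) ^ 2 * √(ε x) ^ 2 * h5 - √μ * √(ε x) * h4

theorem slowness_mul_impedance_sq (h : IsMedium X ε μ) {x : ℝ} (hx : x ∈ X) :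
    √μ * √(ε x) * impedance ε μ x ^ 2 = ε x := by
  have h4 := h.sqrt_waveSpeed_sq hx
  have h5 := Real.sq_sqrt (h.eps_pos x hx).le
  rw [impedance]
  linear_combination √(ε x) ^ 2 * h4 + h5

end IsMedium

end Medium

/-! ### Equivalence of the Maxwell system and the Vekua equation -/

section MaxwellVekua

namespace IsMedium

variable {X S : Set ℝ} {ε : ℝ → ℝ} {μ : ℝ} {a : ℝ → ℝ} {E u : ℝ × ℝ → ℂ}

theorem position_mem_maxwellDomain {p : ℝ × ℝ} (hp : p ∈ cauchyDomain (travelTime ε μ '' X) S) :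
    (position X ε μ p.1, p.2) ∈ maxwellDomain X S ε μ := by
  refine ⟨position_mem hp.1, ?_⟩
  simpa only [travelTime_position hp.1] using hp

theorem contDiffOn_of_transport (h : IsMedium X ε μ)
    (ha : ContDiffOn ℝ 1 a (travelTime ε μ '' X)) (hE : ContDiffOn ℝ 1 E (maxwellDomain X S ε μ))
    (hu : ∀ q ∈ maxwellDomain X S ε μ,
      u (travelTime ε μ q.1, q.2) = a (travelTime ε μ q.1) • E q) :
    ContDiffOn ℝ 1 u (cauchyDomain (travelTime ε μ '' X) S) := by
  have hpos : ContDiffOn ℝ 1 (fun p : ℝ × ℝ => (position X ε μ p.1, p.2))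
      (cauchyDomain (travelTime ε μ '' X) S) :=
    ((h.contDiffOn_position.of_le (by norm_num)).comp contDiffOn_fst fun p hp => hp.1).prodMk
      contDiffOn_snd
  refine ((ha.comp contDiffOn_fst fun p hp => hp.1).smul
    (hE.comp hpos fun p hp => position_mem_maxwellDomain hp)).congr fun p hp => ?_
  have := hu _ (position_mem_maxwellDomain hp)
  simp only [travelTime_position hp.1] at this
  exact this

theorem contDiffOn_transport (h : IsMedium X ε μ)
    (ha : ContDiffOn ℝ 1 a (travelTime ε μ '' X))
    (hu : ContDiffOn ℝ 1 u (cauchyDomain (travelTime ε μ '' X) S))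
    (hE : ∀ q ∈ maxwellDomain X S ε μ,
      E q = a (travelTime ε μ q.1) • u (travelTime ε μ q.1, q.2)) :
    ContDiffOn ℝ 1 E (maxwellDomain X S ε μ) := by
  have ht : ContDiffOn ℝ 1 (fun q : ℝ × ℝ => travelTime ε μ q.1) (maxwellDomain X S ε μ) :=
    h.contDiffOn_travelTime.comp contDiffOn_fst fun p hp => hp.1
  exact ((ha.comp ht fun q hq => mem_image_of_mem _ hq.1).smul
    (hu.comp (ht.prodMk contDiffOn_snd) fun q hq => hq.2)).congr hE

/-- The product and chain rules for u = a · (E ∘ position). It is applied with a = F to E and with a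
= F⁻¹ to iH. -/
theorem fderivWithin_transport (h : IsMedium X ε μ) (hS : S.OrdConnected) (hSn : S.Nontrivial)
    {q : ℝ × ℝ} (hq : q ∈ maxwellDomain X S ε μ) {a' : ℝ}
    (ha : HasDerivWithinAt a a' (travelTime ε μ '' X) (travelTime ε μ q.1))
    {E' : ℝ × ℝ →L[ℝ] ℂ} (hE : HasFDerivWithinAt E E' (maxwellDomain X S ε μ) q)
    (hu : ∀ q ∈ maxwellDomain X S ε μ,
      u (travelTime ε μ q.1, q.2) = a (travelTime ε μ q.1) • E q) :
    fderivWithin ℝ u (cauchyDomain (travelTime ε μ '' X) S) (travelTime ε μ q.1, q.2) (1, 0) =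
      a' * E q + a (travelTime ε μ q.1) * ((√μ * √(ε q.1) : ℝ) : ℂ)⁻¹ *
        E' (1, 0) ∧
    fderivWithin ℝ u (cauchyDomain (travelTime ε μ '' X) S) (travelTime ε μ q.1, q.2) (0, 1) =
      a (travelTime ε μ q.1) * E' (0, 1) := by
  set D := cauchyDomain (travelTime ε μ '' X) S with hD
  set p : ℝ × ℝ := (travelTime ε μ q.1, q.2) with hp
  have hpD : p ∈ D := hq.2
  have hpos : position X ε μ p.1 = q.1 := h.position_travelTime hq.1
  have hud := cauchyDomain_uniqueDiffOn h.ordConnected_image h.nontrivial_image h.zero_mem_image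
    hS hSn p hpD
  have d1 : HasFDerivWithinAt (fun w : ℝ × ℝ => position X ε μ w.1) _ D p :=
    (h.hasDerivWithinAt_position hpD.1).hasFDerivWithinAt.comp p hasFDerivWithinAt_fst
      fun w hw => hw.1
  have d2 : HasFDerivWithinAt (fun w : ℝ × ℝ => (position X ε μ w.1, w.2)) _ D p :=
    d1.prodMk hasFDerivWithinAt_snd
  have d3 : HasFDerivWithinAt E E'
      (maxwellDomain X S ε μ) (position X ε μ p.1, p.2) := by
    rw [hpos]
    exact hE
  have d4 : HasFDerivWithinAt (fun w : ℝ × ℝ => a w.1) _ D p :=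
    ha.hasFDerivWithinAt.comp p hasFDerivWithinAt_fst fun w hw => hw.1
  have d5 := d4.smul (d3.comp p d2 fun w hw => position_mem_maxwellDomain hw)
  have hcongr : ∀ w ∈ D, u w = a w.1 • E (position X ε μ w.1, w.2) := fun w hw => by
    have := hu _ (position_mem_maxwellDomain hw)
    simpa only [travelTime_position hw.1] using this
  have d6 := d5.congr hcongr (hcongr p hpD)
  rw [d6.fderivWithin hud]
  have s1 : ∀ c : ℝ, ((c, 0) : ℝ × ℝ) = c • (1, 0) := fun c => by simp
  have hpos' : (position X ε μ p.1, p.2) = q := by rw [hpos]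
  constructor
  · simp [hpos]
    rw [s1, map_smul]
    simp [p]
    ring
  · simp [hpos', p]

end IsMedium

/-- The terms with F' cancel. What remains of the first Vekua component is -i/(μF) times the second
Maxwell equation, and of the second component -1/(Fn) times the first; the crossing explains
`and_comm`. -/
theorem maxwell_vekua_algebra {F F' n ε μ E H Ex Et Hx Ht : ℂ} (hF : F ≠ 0) (hn : n ≠ 0)
    (hμ : μ ≠ 0) (h₁ : n = μ * F ^ 2) (h₂ : n * F ^ 2 = ε) :
    (ε * Et = Complex.I * Hx ∧ Complex.I * Ex = -μ * Ht) ↔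
      (F' * E + F * n⁻¹ * Ex - F⁻¹ * (Complex.I * Ht) = F' / F * (F * E) ∧
        -F' / F ^ 2 * (Complex.I * H) + F⁻¹ * n⁻¹ * (Complex.I * Hx) - F * Et =
          -(F' / F) * (F⁻¹ * (Complex.I * H))) := by
  have k₁ : F' * E + F * n⁻¹ * Ex - F⁻¹ * (Complex.I * Ht) - F' / F * (F * E) =
      -Complex.I / (μ * F) * (Complex.I * Ex - -μ * Ht) := by
    rw [h₁]
    field_simp
    linear_combination Ex * Complex.I_sq
  have k₂ : -F' / F ^ 2 * (Complex.I * H) + F⁻¹ * n⁻¹ * (Complex.I * Hx) - F * Et -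
      -(F' / F) * (F⁻¹ * (Complex.I * H)) = -(F * n)⁻¹ * (ε * Et - Complex.I * Hx) := by
    rw [← h₂]
    field_simp
    ring
  rw [← sub_eq_zero (b := F' / F * (F * E)), k₁,
    ← sub_eq_zero (b := -(F' / F) * (F⁻¹ * (Complex.I * H))), k₂, mul_eq_zero_iff_left,
    mul_eq_zero_iff_left, sub_eq_zero, sub_eq_zero, and_comm]
  · exact neg_ne_zero.2 (inv_ne_zero (mul_ne_zero hF hn))
  · exact div_ne_zero (neg_ne_zero.2 Complex.I_ne_zero) (mul_ne_zero hμ hF)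

variable {X S : Set ℝ} {ε : ℝ → ℝ} {μ : ℝ} {f : ℝ → ℝ} {E₀ H₀ : ℝ → ℂ} {E H : ℝ × ℝ → ℂ}
  {W : ℝ × ℝ → Bicomplex}

theorem isMaxwellSolution_iff_isVekuaSolution (h : IsMedium X ε μ) (hS : S.OrdConnected)
    (hSn : S.Nontrivial)
    (hf : ∀ x ∈ X, f (travelTime ε μ x) = √(waveSpeed ε μ 0) / √(waveSpeed ε μ x))
    (hW : ∀ p ∈ maxwellDomain X S ε μ, W (travelTime ε μ p.1, p.2) =
      ofC (√(waveSpeed ε μ p.1) : ℝ) *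
        (ofC ((√(ε p.1) : ℝ) * E p) + ofC Complex.I * j * ofC ((√μ : ℝ) * H p))) :
    IsMaxwellSolution X S ε μ E₀ H₀ E H ↔
      IsVekuaSolution (travelTime ε μ '' X) S f
        (fun t => ofC ((√(waveSpeed ε μ 0 * ε 0) : ℝ) * E₀ t) +
          ofC Complex.I * j * ofC ((√(waveSpeed ε μ 0 * μ) : ℝ) * H₀ t)) W := by
  have hA := h.isAdmissible hf
  set J := travelTime ε μ '' X with hJ
  -- This is the impedance factor at x = 0, where f = 1.
  set κ : ℝ := (√μ * √(waveSpeed ε μ 0))⁻¹ with hκ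
  have hκ0 : κ ≠ 0 := inv_ne_zero (mul_pos (Real.sqrt_pos.2 h.mu_pos)
    (Real.sqrt_pos.2 (h.waveSpeed_pos h.zero_mem))).ne'
  have him : ∀ x ∈ X, IsMedium.impedance ε μ x = κ * f (travelTime ε μ x) := fun x hx =>
    h.impedance_eq hf hx
  have hre : ∀ q ∈ maxwellDomain X S ε μ, (W (travelTime ε μ q.1, q.2)).re =
      (κ * f (travelTime ε μ q.1)) • E q := fun q hq => by
    rw [hW q hq, ← him q.1 hq.1, IsMedium.impedance]
    simp [ofC, j]
    ring
  have hIm : ∀ q ∈ maxwellDomain X S ε μ, (W (travelTime ε μ q.1, q.2)).im =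
      (κ * f (travelTime ε μ q.1))⁻¹ • (Complex.I * H q) := fun q hq => by
    rw [hW q hq, ← him q.1 hq.1, ← h.impedance_inv hq.1]
    simp [ofC, j]
    ring
  have hF0 : ∀ y ∈ J, κ * f y ≠ 0 := fun y hy => mul_ne_zero hκ0 (hA.ne_zero y hy)
  have hF : ContDiffOn ℝ 1 (fun y => κ * f y) J :=
    contDiffOn_const.mul (hA.contDiffOn.of_le (by norm_num))
  have hFi : ContDiffOn ℝ 1 (fun y => (κ * f y)⁻¹) J := hF.inv hF0
  have hC1 : (ContDiffOn ℝ 1 E (maxwellDomain X S ε μ) ∧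
      ContDiffOn ℝ 1 H (maxwellDomain X S ε μ)) ↔ C1On W (cauchyDomain J S) := by
    constructor
    · rintro ⟨hE, hH⟩
      exact ⟨h.contDiffOn_of_transport hF hE hre,
        h.contDiffOn_of_transport hFi (contDiffOn_const.mul hH) hIm⟩
    · rintro ⟨hu, hv⟩
      refine ⟨h.contDiffOn_transport hFi hu fun q hq => ?_,
        h.contDiffOn_transport hF (contDiffOn_const.mul hv)
          -- The factor -i undoes the i in front of H.
          (u := fun p => -Complex.I * (W p).im) fun q hq => ?_⟩
      · rw [hre q hq, inv_smul_smul₀ (hF0 _ ⟨_, hq.1, rfl⟩)]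
      · rw [hIm q hq, mul_smul_comm, smul_inv_smul₀ (hF0 _ ⟨_, hq.1, rfl⟩), ← mul_assoc,
          neg_mul, Complex.I_mul_I, neg_neg, one_mul]
  have heq : ContDiffOn ℝ 1 E (maxwellDomain X S ε μ) →
      ContDiffOn ℝ 1 H (maxwellDomain X S ε μ) → ∀ q ∈ maxwellDomain X S ε μ,
      ((ε q.1 : ℂ) * fderivWithin ℝ E (maxwellDomain X S ε μ) q (0, 1) =
          Complex.I * fderivWithin ℝ H (maxwellDomain X S ε μ) q (1, 0) ∧
        Complex.I * fderivWithin ℝ E (maxwellDomain X S ε μ) q (1, 0) =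
          -(μ : ℂ) * fderivWithin ℝ H (maxwellDomain X S ε μ) q (0, 1)) ↔
      dbar W (cauchyDomain J S) (travelTime ε μ q.1, q.2) -
        ofC ((derivWithin f J (travelTime ε μ q.1) / (2 * f (travelTime ε μ q.1)) : ℝ) : ℂ) *
          star (W (travelTime ε μ q.1, q.2)) = 0 := by
    intro hE hH q hq
    have hyJ : travelTime ε μ q.1 ∈ J := ⟨_, hq.1, rfl⟩
    have dE := hE.differentiableOn one_ne_zero
    have dH := hH.differentiableOn one_ne_zero
    have dF := (hA.hasDerivWithinAt hyJ).const_mul κ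
    have dFi := dF.fun_inv (hF0 _ hyJ)
    obtain ⟨u1, u2⟩ := h.fderivWithin_transport hS hSn hq dF
      (dE q hq).hasFDerivWithinAt (u := fun p => (W p).re) hre
    obtain ⟨v1, v2⟩ := h.fderivWithin_transport (E := fun q => Complex.I * H q) hS hSn hq dFi
      ((dH q hq).hasFDerivWithinAt.const_mul Complex.I) (u := fun p => (W p).im) hIm
    have hm1 := h.slowness_eq_mul_impedance_sq hq.1
    have hm2 := h.slowness_mul_impedance_sq hq.1
    have hn0 := (h.slowness_pos hq.1).ne'
    rw [him q.1 hq.1] at hm1 hm2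
    have hL : logDerivWithin J f (travelTime ε μ q.1) =
        κ * derivWithin f J (travelTime ε μ q.1) / (κ * f (travelTime ε μ q.1)) :=
      (mul_div_mul_left _ _ hκ0).symm
    rw [vekua_equation_iff, u1, u2, v1, v2, hre q hq, hIm q hq, hL]
    have key := maxwell_vekua_algebra (F := ((κ * f (travelTime ε μ q.1) : ℝ) : ℂ))
      (F' := ((κ * derivWithin f J (travelTime ε μ q.1) : ℝ) : ℂ))
      (n := ((√μ * √(ε q.1) : ℝ) : ℂ)) (ε := ε q.1) (μ := μ) (E := E q) (H := H q)
      (Ex := fderivWithin ℝ E (maxwellDomain X S ε μ) q (1, 0))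
      (Et := fderivWithin ℝ E (maxwellDomain X S ε μ) q (0, 1))
      (Hx := fderivWithin ℝ H (maxwellDomain X S ε μ) q (1, 0))
      (Ht := fderivWithin ℝ H (maxwellDomain X S ε μ) q (0, 1))
      (by exact_mod_cast hF0 _ hyJ) (by exact_mod_cast hn0) (by exact_mod_cast h.mu_pos.ne')
      (by exact_mod_cast hm1) (by exact_mod_cast hm2)
    rw [key]
    simp only [Complex.real_smul, _root_.smul_apply, smul_eq_mul, Complex.ofReal_inv,
      Complex.ofReal_div, Complex.ofReal_neg, Complex.ofReal_pow]
  have hinit : (∀ t ∈ S, W (0, t) = ofC ((√(waveSpeed ε μ 0 * ε 0) : ℝ) * E₀ t) +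
        ofC Complex.I * j * ofC ((√(waveSpeed ε μ 0 * μ) : ℝ) * H₀ t)) ↔
      (∀ t ∈ S, E (0, t) = E₀ t) ∧ ∀ t ∈ S, H (0, t) = H₀ t := by
    rw [← forall₂_and]
    refine forall₂_congr fun t ht => ?_
    have hq : ((0, t) : ℝ × ℝ) ∈ maxwellDomain X S ε μ := by
      refine ⟨h.zero_mem, ?_⟩
      simp only [IsMedium.travelTime_zero]
      exact zero_mem_cauchyDomain h.zero_mem_image ht
    have hc := (h.waveSpeed_pos h.zero_mem).le
    have h1 := hW _ hq
    simp only [IsMedium.travelTime_zero] at h1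
    rw [h1, Real.sqrt_mul hc, Real.sqrt_mul hc, QuadraticAlgebra.ext_iff]
    have c0 : (√(waveSpeed ε μ 0) : ℂ) ≠ 0 :=
      Complex.ofReal_ne_zero.2 (Real.sqrt_pos.2 (h.waveSpeed_pos h.zero_mem)).ne'
    have e0 : (√(ε 0) : ℂ) ≠ 0 :=
      Complex.ofReal_ne_zero.2 (Real.sqrt_pos.2 (h.eps_pos 0 h.zero_mem)).ne'
    have m0 : (√μ : ℂ) ≠ 0 := Complex.ofReal_ne_zero.2 (Real.sqrt_pos.2 h.mu_pos).ne'
    simp [ofC, j, mul_assoc, mul_left_comm _ Complex.I, c0, e0, m0]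
  constructor
  · rintro ⟨hE, hH, e1, e2, i1, i2⟩
    refine ⟨hC1.1 ⟨hE, hH⟩, ?_, hinit.2 ⟨i1, i2⟩⟩
    rintro ⟨y, t⟩ hp
    obtain ⟨x, hx, rfl⟩ := hp.1
    exact (heq hE hH (x, t) ⟨hx, hp⟩).1 ⟨e1 _ ⟨hx, hp⟩, e2 _ ⟨hx, hp⟩⟩
  · rintro ⟨hc, he, hi⟩
    obtain ⟨hE, hH⟩ := hC1.2 hc
    have hm := fun q hq => (heq hE hH q hq).2 (he _ hq.2)
    exact ⟨hE, hH, fun q hq => (hm q hq).1, fun q hq => (hm q hq).2, (hinit.1 hi).1,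
      (hinit.1 hi).2⟩

end MaxwellVekua

end

theorem mainTheorem1 :
    -- the Cauchy problem for the hyperbolic Vekua equation
    (∀ (J S : Set ℝ) (f : ℝ → ℝ) (W₀ : ℝ → Bicomplex),
      J.OrdConnected → J.Nontrivial → (0 : ℝ) ∈ J → S.OrdConnected → S.Nontrivial →
      ContDiffOn ℝ 2 f J → (∀ ξ ∈ J, f ξ ≠ 0) → f 0 = 1 → Bicomplex.C1On W₀ S →
      -- the kernels of `T_f` and `T_{1/f}` exist, are unique and continuously differentiable
      (∀ g ∈ ({f, fun ξ => (f ξ)⁻¹} : Set (ℝ → ℝ)),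
        IsTransmutationKernel J g (transmutationKernel J g) ∧
        (∀ K, IsTransmutationKernel J g K →
          Set.EqOn K (transmutationKernel J g) (kernelDomain J)) ∧
        ContDiffOn ℝ 1 (transmutationKernel J g) (kernelDomain J)) ∧
      -- the formula gives a solution, and every solution is given by the formula
      IsVekuaSolution J S f W₀ (vekuaFormula J f W₀) ∧
      ∀ W, IsVekuaSolution J S f W₀ W → Set.EqOn W (vekuaFormula J f W₀) (cauchyDomain J S)) ∧
    -- the equivalence with the transmission problem for the 1+1 Maxwell system
    (∀ (X S : Set ℝ) (ε : ℝ → ℝ) (μ : ℝ) (f : ℝ → ℝ),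
      X.OrdConnected → X.Nontrivial → (0 : ℝ) ∈ X → S.OrdConnected → S.Nontrivial →
      ContDiffOn ℝ 2 ε X → (∀ x ∈ X, 0 < ε x) → 0 < μ →
      (∀ x ∈ X, f (travelTime ε μ x) = √(waveSpeed ε μ 0) / √(waveSpeed ε μ x)) →
      -- the coefficient `f` of the medium is admissible in the first part
      (StrictMonoOn (travelTime ε μ) X ∧
        (travelTime ε μ '' X).OrdConnected ∧ (travelTime ε μ '' X).Nontrivial ∧
        (0 : ℝ) ∈ travelTime ε μ '' X ∧
        ContDiffOn ℝ 2 f (travelTime ε μ '' X) ∧ (∀ ξ ∈ travelTime ε μ '' X, f ξ ≠ 0) ∧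
        f 0 = 1) ∧
      ∀ (E₀ H₀ : ℝ → ℂ) (E H : ℝ × ℝ → ℂ) (W : ℝ × ℝ → Bicomplex),
        ContDiffOn ℝ 1 E₀ S → ContDiffOn ℝ 1 H₀ S →
        (∀ p ∈ maxwellDomain X S ε μ,
          W (travelTime ε μ p.1, p.2) =
            Bicomplex.ofC (√(waveSpeed ε μ p.1) : ℝ) *
              (Bicomplex.ofC ((√(ε p.1) : ℝ) * E p) +
                Bicomplex.ofC Complex.I * Bicomplex.j * Bicomplex.ofC ((√μ : ℝ) * H p))) →
        (IsMaxwellSolution X S ε μ E₀ H₀ E H ↔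
          IsVekuaSolution (travelTime ε μ '' X) S f
            (fun t =>
              Bicomplex.ofC ((√(waveSpeed ε μ 0 * ε 0) : ℝ) * E₀ t) +
                Bicomplex.ofC Complex.I * Bicomplex.j *
                  Bicomplex.ofC ((√(waveSpeed ε μ 0 * μ) : ℝ) * H₀ t)) W)) := by
  refine ⟨fun J S f W₀ hJ hJn h0 hS hSn hf hf0 hf1 hW₀ => ?_,
    fun X S ε μ f hX hXn h0 hS hSn hε hε0 hμ hf => ?_⟩
  · have hA : IsAdmissible J f := ⟨hJ, hJn, h0, hf, hf0, hf1⟩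
    have hsol := isVekuaSolution_vekuaFormula hA hS hSn hW₀
    refine ⟨?_, hsol, fun W hW => hW.unique hA hS hSn hsol⟩
    rintro g (rfl | rfl)
    · exact ⟨hA.isTransmutationKernel, fun K hK => hA.transmutationKernel_unique hK,
        hA.contDiffOn_transmutationKernel⟩
    · exact ⟨hA.inv.isTransmutationKernel, fun K hK => hA.inv.transmutationKernel_unique hK,
        hA.inv.contDiffOn_transmutationKernel⟩
  · have hM : IsMedium X ε μ := ⟨hX, hXn, h0, hε, hε0, hμ⟩
    have hA := hM.isAdmissible hf
    exact ⟨⟨hM.strictMonoOn_travelTime, hA.ordConnected, hA.nontrivial, hA.zero_mem,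
      hA.contDiffOn, hA.ne_zero, hA.map_zero⟩, fun E₀ H₀ E H W _ _ hW =>
      isMaxwellSolution_iff_isVekuaSolution hM hS hSn hf hW⟩
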